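/- Let $\varepsilon>0$ and let $\mathbb S^3_\varepsilon$ be the unit sphere $\mathbb S^3\subset\mathbb R^4=\mathbb C^2$ with the Berger metric $g_\varepsilon(X,Y)=\langle X,Y\rangle+(\varepsilon^2-1)\langle X,X_1\rangle\langle Y,X_1\rangle$, where $X_1(x)=J_1x=(-x_2,x_1,-x_4,x_3)$ is the Hopf vector field; put $E_1=\varepsilon^{-1}X_1$. A helix surface with constant angle $\vartheta$ is a smooth immersed surface $M$ in $\mathbb S^3_\varepsilon$ whose unit normals $N$ (with respect to $g_\varepsilon$) satisfy $|g_\varepsilon(X_1,N)|=\varepsilon\cos\vartheta$. Let $T$ denote the component of $E_1$ tangent to $M$. Let $\vartheta\in[0,\pi/2)$ and put $$B=1+(\varepsilon^2-1)\cos^2\vartheta,\quad \alpha_{1,2}=\frac1\varepsilon\left(B\pm\varepsilon\sqrt B\cos\vartheta\right),\quad g_{11}=\frac{\varepsilon}{2B}\alpha_2,\quad g_{33}=\frac{\varepsilon}{2B}\alpha_1,$$ $$\beta(u)=\left(\sqrt{g_{11}}\cos(\alpha_1u),\sqrt{g_{11}}\sin(\alpha_1u),\sqrt{g_{33}}\cos(\alpha_2u),\sqrt{g_{33}}\sin(\alpha_2u)\right).$$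 Let $J_2x=(-x_4,-x_3,x_2,x_1)$, $J_3x=(-x_3,x_4,x_1,-x_2)$ and, for real functions $\xi,\xi_1,\xi_2,\xi_3$ of $v$, let $$\mathbf r_1=(\cos\xi_1\cos\xi_2,\,-\cos\xi_1\sin\xi_2,\,\sin\xi_1\cos\xi_3,\,-\sin\xi_1\sin\xi_3)$$ and let $A(v)=A(\xi,\xi_1,\xi_2,\xi_3)(v)$ be the $4\times4$ matrix with rows $$\mathbf r_1,\quad J_1\mathbf r_1,\quad \cos\xi\,J_2\mathbf r_1+\sin\xi\,J_3\mathbf r_1,\quad -\cos\xi\,J_3\mathbf r_1+\sin\xi\,J_2\mathbf r_1.$$ Call $(\xi,\xi_1,\xi_2,\xi_3)$ admissible on an open interval $I$ if the four functions are smooth on $I$, $\xi$ is constant on $I$, and $$\cos^2(\xi_1(v))\,\xi_2'(v)-\sin^2(\xi_1(v))\,\xi_3'(v)=0\qquad (v\in I).$$ (a) Let $M$ be a helix surface in $\mathbb S^3_\varepsilon$ with constant angle $\vartheta$, and let $p\in M$. Then $g_{11},g_{33}>0$, the torus $\mathbb S^1(\sqrt{g_{11}})\times\mathbb S^1(\sqrt{g_{33}})$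 is contained in $\mathbb S^3$, and $\beta$ is a geodesic of this torus (with the metric induced by the canonical one). Moreover, there are smooth local coordinates $(u,v)\in(a,b)\times(c,d)$ on a neighbourhood of $p$ in $M$ with $\partial_u=T$, and functions $(\xi,\xi_1,\xi_2,\xi_3)$ admissible on $(c,d)$, such that every $A(v)$, $v\in(c,d)$, is an orthogonal matrix commuting with $J_1$ and the position vector of $M$ in $\mathbb R^4$ is $$F(u,v)=A(v)\,\beta(u).$$ (b) Conversely, let $(\xi,\xi_1,\xi_2,\xi_3)$ be admissible on an open interval $I$, and let $U\subset\mathbb R\times I$ be an open set on which $F(u,v)=A(v)\,\beta(u)$ is an immersion. Then $F:U\to\mathbb S^3_\varepsilon$ is a helix surface with constant angle $\vartheta$. -/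

import Mathlib

open scoped Manifold ContDiff Matrix

noncomputable section

namespace BergerHelix

/-- The Euclidean space `ℝ⁴ = ℂ²`, where `(z, w) = (x 0 + i x 1, x 2 + i x 3)`. -/
abbrev R4 : Type := EuclideanSpace ℝ (Fin 4)

/-- The coordinate plane; the coordinates are `u = x 0` and `v = x 1`. -/
abbrev R2 : Type := EuclideanSpace ℝ (Fin 2)

/-! ### The Berger sphere, described inside `ℝ⁴` -/

/-- The complex structure `J₁` of `ℝ⁴` (multiplication by `i` on `ℂ²`). -/
def J1 : Matrix (Fin 4) (Fin 4) ℝ :=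
  !![0, -1, 0, 0;
     1, 0, 0, 0;
     0, 0, 0, -1;
     0, 0, 1, 0]

/-- The complex structure `J₂` of `ℝ⁴`. -/
def J2 : Matrix (Fin 4) (Fin 4) ℝ :=
  !![0, 0, 0, -1;
     0, 0, -1, 0;
     0, 1, 0, 0;
     1, 0, 0, 0]

/-- The complex structure `J₃` of `ℝ⁴`. -/
def J3 : Matrix (Fin 4) (Fin 4) ℝ :=
  !![0, 0, -1, 0;
     0, 0, 0, 1;
     1, 0, 0, 0;
     0, -1, 0, 0]

/-- A matrix acting on a vector of `ℝ⁴`. -/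
def act (A : Matrix (Fin 4) (Fin 4) ℝ) (x : R4) : R4 := WithLp.toLp 2 (A *ᵥ x.ofLp)

/-- The Hopf vector field `X₁(z, w) = (i z, i w)`. -/
def hopfField (x : R4) : R4 := act J1 x

/-- The Berger metric `g_ε` at the point `p` of the unit sphere, evaluated on `X, Y ∈ T_p 𝕊³ ⊂ ℝ⁴`. -/
def bergerMetric (ε : ℝ) (p X Y : R4) : ℝ :=
  inner ℝ X Y + (ε ^ 2 - 1) * inner ℝ X (hopfField p) * inner ℝ Y (hopfField p)

/-! ### Helix surfaces -/

section Surface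

variable {M : Type*} [TopologicalSpace M] [ChartedSpace R2 M]

/-- The differential `df_p : T_p M → ℝ⁴`. -/
def push (f : M → R4) (p : M) (w : TangentSpace (𝓡 2) p) : R4 :=
  mfderiv (𝓡 2) 𝓘(ℝ, R4) f p w

/-- `n ∈ T_{f p} 𝕊³` is a unit normal, for the Berger metric, of the surface `f : M → 𝕊³ ⊂ ℝ⁴`
at the point `p`. -/
structure IsUnitNormal (ε : ℝ) (f : M → R4) (p : M) (n : R4) : Prop where
  tangent_sphere : inner ℝ (f p) n = 0
  normal : ∀ w : TangentSpace (𝓡 2) p,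
    bergerMetric ε (f p) n (push f p w) = 0
  unit : bergerMetric ε (f p) n n = 1

/-- The smooth surface `M`, immersed by `f` in the unit sphere of `ℝ⁴`, is a helix surface of the
Berger sphere `𝕊³_ε` with constant angle `θ`. (Unit normals are taken pointwise; the condition does
not depend on their sign.) -/
structure IsHelixSurface (ε θ : ℝ) (f : M → R4) : Prop where
  smooth : ContMDiff (𝓡 2) 𝓘(ℝ, R4) ∞ f
  mem_sphere : ∀ p, f p ∈ Metric.sphere (0 : R4) 1
  immersion : ∀ p, Function.Injective (push f p)
  angle : ∀ p n, IsUnitNormal ε f p n →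
    |bergerMetric ε (f p) (hopfField (f p)) n| = ε * Real.cos θ

/-- `t ∈ T_p M` is the tangential component `T` of the unit field `E₁ = ε⁻¹ X₁`: the difference
`E₁ - df t` is `g_ε`-orthogonal to the surface. -/
def IsHopfTangentPart (ε : ℝ) (f : M → R4) (p : M) (t : TangentSpace (𝓡 2) p) : Prop :=
  ∀ w : TangentSpace (𝓡 2) p,
    bergerMetric ε (f p) (ε⁻¹ • hopfField (f p) - push f p t) (push f p w) = 0

end Surface

/-! ### Geodesics of a submanifold of `ℝ⁴` -/

/-- `w` is the velocity at `x` of a smooth curve lying in `S`. -/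
def IsTangentTo (S : Set R4) (x w : R4) : Prop :=
  ∃ c : ℝ → R4, ContDiffAt ℝ ∞ c 0 ∧ (∀ᶠ t in nhds 0, c t ∈ S) ∧ c 0 = x ∧ deriv c 0 = w

/-- `γ` is a geodesic of the submanifold `S` of `ℝ⁴`, with the metric induced by the canonical one:
it is a smooth curve in `S` whose acceleration has vanishing tangential component. -/
structure IsGeodesicOf (S : Set R4) (γ : ℝ → R4) : Prop where
  smooth : ContDiff ℝ ∞ γ
  mem : ∀ t, γ t ∈ S
  accel_normal : ∀ t w, IsTangentTo S (γ t) w → inner ℝ (deriv (deriv γ) t) w = 0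

/-- The torus `𝕊¹(r₁) × 𝕊¹(r₂)` in `ℝ² × ℝ² = ℝ⁴`. -/
def torus (r₁ r₂ : ℝ) : Set R4 :=
  {x | x 0 ^ 2 + x 1 ^ 2 = r₁ ^ 2 ∧ x 2 ^ 2 + x 3 ^ 2 = r₂ ^ 2}

/-! ### The constants, the curve `β` and the matrices `A` -/

/-- `B = 1 + (ε² - 1) cos² θ`. -/
def constB (ε θ : ℝ) : ℝ := 1 + (ε ^ 2 - 1) * Real.cos θ ^ 2

/-- `α₁ = (B + ε √B cos θ) / ε`. -/
def alpha1 (ε θ : ℝ) : ℝ := 1 / ε * (constB ε θ + ε * √(constB ε θ) * Real.cos θ)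

/-- `α₂ = (B - ε √B cos θ) / ε`. -/
def alpha2 (ε θ : ℝ) : ℝ := 1 / ε * (constB ε θ - ε * √(constB ε θ) * Real.cos θ)

/-- `g₁₁ = ε α₂ / (2 B)`. -/
def g11 (ε θ : ℝ) : ℝ := ε / (2 * constB ε θ) * alpha2 ε θ

/-- `g₃₃ = ε α₁ / (2 B)`. -/
def g33 (ε θ : ℝ) : ℝ := ε / (2 * constB ε θ) * alpha1 ε θ

/-- The curve `β`. -/
def beta (ε θ u : ℝ) : R4 :=
  !₂[√(g11 ε θ) * Real.cos (alpha1 ε θ * u), √(g11 ε θ) * Real.sin (alpha1 ε θ * u),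
     √(g33 ε θ) * Real.cos (alpha2 ε θ * u), √(g33 ε θ) * Real.sin (alpha2 ε θ * u)]

/-- The first row `r₁` of the matrix `A(ξ, ξ₁, ξ₂, ξ₃)`. -/
def row1 (ξ₁ ξ₂ ξ₃ : ℝ) : Fin 4 → ℝ :=
  ![Real.cos ξ₁ * Real.cos ξ₂, -(Real.cos ξ₁ * Real.sin ξ₂),
    Real.sin ξ₁ * Real.cos ξ₃, -(Real.sin ξ₁ * Real.sin ξ₃)]

/-- The matrix `A(ξ, ξ₁, ξ₂, ξ₃)`, given by its rows. -/
def matA (ξ ξ₁ ξ₂ ξ₃ : ℝ) : Matrix (Fin 4) (Fin 4) ℝ :=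
  Matrix.of ![row1 ξ₁ ξ₂ ξ₃,
    J1 *ᵥ row1 ξ₁ ξ₂ ξ₃,
    Real.cos ξ • (J2 *ᵥ row1 ξ₁ ξ₂ ξ₃) + Real.sin ξ • (J3 *ᵥ row1 ξ₁ ξ₂ ξ₃),
    -(Real.cos ξ • (J3 *ᵥ row1 ξ₁ ξ₂ ξ₃)) + Real.sin ξ • (J2 *ᵥ row1 ξ₁ ξ₂ ξ₃)]

/-- The conditions on the smooth functions `ξ, ξ₁, ξ₂, ξ₃` on the open interval `I`: `ξ` is constant
and `cos² ξ₁ · ξ₂' - sin² ξ₁ · ξ₃' = 0`. -/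
structure IsAdmissible (I : Set ℝ) (ξ ξ₁ ξ₂ ξ₃ : ℝ → ℝ) : Prop where
  smooth : ContDiffOn ℝ ∞ ξ I
  smooth₁ : ContDiffOn ℝ ∞ ξ₁ I
  smooth₂ : ContDiffOn ℝ ∞ ξ₂ I
  smooth₃ : ContDiffOn ℝ ∞ ξ₃ I
  const : ∃ k : ℝ, ∀ v ∈ I, ξ v = k
  ode : ∀ v ∈ I, Real.cos (ξ₁ v) ^ 2 * deriv ξ₂ v - Real.sin (ξ₁ v) ^ 2 * deriv ξ₃ v = 0

/-- The map `F(u, v) = A(v) β(u)`, where `A(v) = A(ξ, ξ₁, ξ₂, ξ₃)(v)`. -/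
def helixMap (ε θ : ℝ) (ξ ξ₁ ξ₂ ξ₃ : ℝ → ℝ) (x : R2) : R4 :=
  act (matA (ξ (x 1)) (ξ₁ (x 1)) (ξ₂ (x 1)) (ξ₃ (x 1))) (beta ε θ (x 0))

end BergerHelix

end

set_option linter.unusedSimpArgs false

/-! Regard `ℝ⁴` as the quaternions, with `J₁, J₂, J₃` acting from one side. Then `p, J₁p, J₂p, J₃p`
is an orthonormal basis at every unit vector `p`. A matrix `A` whose first row is a unit vector `r`
is a multiplication from the other side, followed by a rotation of the last two coordinates that
depends on `ξ` alone. It is orthogonal and commutes with `J₁`, so it preserves the Berger metric.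
For constant `ξ`, the vector `A β` is bilinear in `r` and `β` (`rowsApply`).

Converse. Write `σ(z, w) = (iz, -iw)`. The velocity `β'` is a combination of `J₁β` and `σβ`, and the
differential equation on `ξ₁, ξ₂, ξ₃` says exactly that `A'β ⊥ A σβ`. Hence `E₁ - A β'` is
orthogonal to the surface (`bergerMetric_rowsApply`) and has length `cos θ`
(`bergerMetric_normal_part`). The normal line is one-dimensional, so the angle is determined
(`angle_of_normal_part`).

Direct part. The angle condition says that the surface is Euclidean-orthogonal to `ν = ε cos θ J₁f +
l J₂f + m J₃f` with `l² + m² = sin² θ` (`exists_normalPair`). Differentiating `⟨df, ν⟩ = 0` and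
using symmetry of second derivatives (`inner_fderiv_symm`) rules out `θ = 0`. Otherwise `(l, m) =
sin θ (cos φ, sin φ)`, and the same symmetry gives `T φ = -2B/ε` (`fderiv_angle`). With `u = -φ/(α₁
+ α₂)` one gets `T u = 1`, and `T` has the same frame components at `f` as `β'` has at `β(u)`.
Therefore the matrix `A` with `f = A β(u)` is constant along `T` (`exists_movingFrame`).

In coordinates `(u, v)`, where `v` is an entry of the first row `r` of `A`, the row depends on `v`
only, and `df ⊥ ν` becomes the differential equation for `r`. The angles `ξ₁, ξ₂, ξ₃` come from
polar coordinates of the two complex entries of `r`. These entries may vanish, but regularity of the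
curve forces such zeros to be simple, so signed polar coordinates stay smooth (`exists_polar`,
`exists_admissible`). -/

namespace BergerHelix

/-! ### The linear family of matrices -/

/-- The vector `A x`, where the first row of `A` is `r` and the other rows are obtained from `r` as
in `matA`. -/
noncomputable def rowsApply (k : ℝ) (r x : R4) : R4 :=
  !₂[r 0 * x 0 + r 1 * x 1 + r 2 * x 2 + r 3 * x 3,
    -r 1 * x 0 + r 0 * x 1 - r 3 * x 2 + r 2 * x 3,
    Real.cos k * (-r 3 * x 0 - r 2 * x 1 + r 1 * x 2 + r 0 * x 3)
      + Real.sin k * (-r 2 * x 0 + r 3 * x 1 + r 0 * x 2 - r 1 * x 3),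
    -Real.cos k * (-r 2 * x 0 + r 3 * x 1 + r 0 * x 2 - r 1 * x 3)
      + Real.sin k * (-r 3 * x 0 - r 2 * x 1 + r 1 * x 2 + r 0 * x 3)]

theorem act_matA (k a b c : ℝ) (x : R4) :
    act (matA k a b c) x = rowsApply k (WithLp.toLp 2 (row1 a b c)) x := by
  ext i
  fin_cases i <;>
    simp [act, matA, rowsApply, row1, J1, J2, J3, Matrix.mulVec, dotProduct, Fin.sum_univ_four] <;>
    ring

noncomputable def rowsApplyL (k : ℝ) : R4 →L[ℝ] R4 →L[ℝ] R4 :=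
  LinearMap.toContinuousBilinearMap (LinearMap.mk₂ ℝ (rowsApply k)
    (by intros; ext i; fin_cases i <;> simp [rowsApply] <;> ring)
    (by intros; ext i; fin_cases i <;> simp [rowsApply] <;> ring)
    (by intros; ext i; fin_cases i <;> simp [rowsApply] <;> ring)
    (by intros; ext i; fin_cases i <;> simp [rowsApply] <;> ring))

theorem rowsApplyL_apply (k : ℝ) (r x : R4) : rowsApplyL k r x = rowsApply k r x := rfl

theorem inner_R4 (x y : R4) :
    inner ℝ x y = x 0 * y 0 + x 1 * y 1 + x 2 * y 2 + x 3 * y 3 := by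
  simp [PiLp.inner_apply, Fin.sum_univ_four]; ring

theorem mem_sphere_iff (x : R4) :
    x ∈ Metric.sphere (0 : R4) 1 ↔ x 0 ^ 2 + x 1 ^ 2 + x 2 ^ 2 + x 3 ^ 2 = 1 := by
  rw [mem_sphere_zero_iff_norm, ← pow_eq_one_iff_of_nonneg (norm_nonneg x) two_ne_zero,
    EuclideanSpace.real_norm_sq_eq, Fin.sum_univ_four]

theorem hopfField_eq (x : R4) : hopfField x = !₂[-x 1, x 0, -x 3, x 2] := by
  ext i
  fin_cases i <;> simp [hopfField, act, J1, Matrix.mulVec, dotProduct, Fin.sum_univ_four]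

theorem matA_mem_orthogonalGroup (k a b c : ℝ) :
    matA k a b c ∈ Matrix.orthogonalGroup (Fin 4) ℝ := by
  have hk := Real.cos_sq_add_sin_sq k
  have ha := Real.cos_sq_add_sin_sq a
  have hb := Real.cos_sq_add_sin_sq b
  have hc := Real.cos_sq_add_sin_sq c
  have hr : Real.cos a ^ 2 * Real.cos b ^ 2 + Real.cos a ^ 2 * Real.sin b ^ 2
      + Real.sin a ^ 2 * Real.cos c ^ 2 + Real.sin a ^ 2 * Real.sin c ^ 2 = 1 := by
    linear_combination Real.cos a ^ 2 * hb + Real.sin a ^ 2 * hc + ha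
  rw [Matrix.mem_orthogonalGroup_iff]
  ext i j
  fin_cases i <;> fin_cases j <;>
    simp [matA, row1, J1, J2, J3, Matrix.mul_apply, Matrix.mulVec, dotProduct, Fin.sum_univ_four,
      Matrix.star_eq_conjTranspose] <;>
    first
    | ring1
    | linear_combination hr
    | linear_combination hk + (Real.cos k ^ 2 + Real.sin k ^ 2) * hr

theorem matA_commute_J1 (k a b c : ℝ) : Commute (matA k a b c) J1 := by
  ext i j
  fin_cases i <;> fin_cases j <;>
    simp [matA, row1, J1, J2, J3, Matrix.mul_apply, Matrix.mulVec, dotProduct, Fin.sum_univ_four] <;>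
    ring

/-! ### The constants -/

section Constants

variable {ε θ : ℝ}

theorem constB_eq : constB ε θ = (ε * Real.cos θ) ^ 2 + Real.sin θ ^ 2 := by
  rw [constB, Real.sin_sq]; ring

theorem cos_pos_of_mem (hθ : θ ∈ Set.Ico 0 (Real.pi / 2)) : 0 < Real.cos θ :=
  Real.cos_pos_of_mem_Ioo ⟨by linarith [hθ.1, Real.pi_pos], hθ.2⟩

theorem constB_pos (hε : 0 < ε) (hθ : θ ∈ Set.Ico 0 (Real.pi / 2)) : 0 < constB ε θ := by
  have := mul_pos hε (cos_pos_of_mem hθ)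
  rw [constB_eq]; positivity

theorem sqrt_constB_pos (hε : 0 < ε) (hθ : θ ∈ Set.Ico 0 (Real.pi / 2)) : 0 < √(constB ε θ) :=
  Real.sqrt_pos.2 (constB_pos hε hθ)

theorem sq_sqrt_constB (hε : 0 < ε) (hθ : θ ∈ Set.Ico 0 (Real.pi / 2)) :
    √(constB ε θ) ^ 2 = (ε * Real.cos θ) ^ 2 + Real.sin θ ^ 2 := by
  rw [Real.sq_sqrt (constB_pos hε hθ).le, constB_eq]

/-- With `b = √B` and `C = ε cos θ` all four constants factor through `b ± C`. Later identities then
become polynomial modulo `b² = C² + sin² θ`. -/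
theorem alpha1_eq (hε : 0 < ε) (hθ : θ ∈ Set.Ico 0 (Real.pi / 2)) :
    ε * alpha1 ε θ = √(constB ε θ) * (√(constB ε θ) + ε * Real.cos θ) := by
  have h := Real.sq_sqrt (constB_pos hε hθ).le
  rw [alpha1]; field_simp; linear_combination -h

theorem alpha2_eq (hε : 0 < ε) (hθ : θ ∈ Set.Ico 0 (Real.pi / 2)) :
    ε * alpha2 ε θ = √(constB ε θ) * (√(constB ε θ) - ε * Real.cos θ) := by
  have h := Real.sq_sqrt (constB_pos hε hθ).le
  rw [alpha2]; field_simp; linear_combination -h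

theorem g11_eq (hε : 0 < ε) (hθ : θ ∈ Set.Ico 0 (Real.pi / 2)) :
    2 * √(constB ε θ) * g11 ε θ = √(constB ε θ) - ε * Real.cos θ := by
  have h := Real.sq_sqrt (constB_pos hε hθ).le
  have hb := sqrt_constB_pos hε hθ
  have h2 := alpha2_eq hε hθ
  have hB := constB_pos hε hθ
  have : g11 ε θ = (ε * alpha2 ε θ) / (2 * constB ε θ) := by rw [g11]; ring
  rw [this, h2]
  field_simp
  linear_combination (√(constB ε θ) - ε * Real.cos θ) * h

theorem g33_eq (hε : 0 < ε) (hθ : θ ∈ Set.Ico 0 (Real.pi / 2)) :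
    2 * √(constB ε θ) * g33 ε θ = √(constB ε θ) + ε * Real.cos θ := by
  have h := Real.sq_sqrt (constB_pos hε hθ).le
  have hb := sqrt_constB_pos hε hθ
  have h2 := alpha1_eq hε hθ
  have hB := constB_pos hε hθ
  have : g33 ε θ = (ε * alpha1 ε θ) / (2 * constB ε θ) := by rw [g33]; ring
  rw [this, h2]
  field_simp
  linear_combination (√(constB ε θ) + ε * Real.cos θ) * h

theorem le_sqrt_constB :
    ε * Real.cos θ ≤ √(constB ε θ) := by
  apply Real.le_sqrt_of_sq_le
  rw [constB_eq]; nlinarith [sq_nonneg (Real.sin θ)]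

theorem g11_nonneg (hε : 0 < ε) (hθ : θ ∈ Set.Ico 0 (Real.pi / 2)) : 0 ≤ g11 ε θ := by
  have h := g11_eq hε hθ
  have h1 := le_sqrt_constB (ε := ε) (θ := θ)
  exact nonneg_of_mul_nonneg_right (by linarith) (show 0 < 2 * √(constB ε θ) by
    linarith [sqrt_constB_pos hε hθ])

theorem g33_nonneg (hε : 0 < ε) (hθ : θ ∈ Set.Ico 0 (Real.pi / 2)) : 0 ≤ g33 ε θ := by
  have h := g33_eq hε hθ
  have h1 := mul_pos hε (cos_pos_of_mem hθ)
  have h2 := sqrt_constB_pos hε hθ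
  exact nonneg_of_mul_nonneg_right (by linarith) (show 0 < 2 * √(constB ε θ) by linarith)

theorem g11_add_g33 (hε : 0 < ε) (hθ : θ ∈ Set.Ico 0 (Real.pi / 2)) :
    g11 ε θ + g33 ε θ = 1 := by
  have h := g33_eq hε hθ
  have h1 := g11_eq hε hθ
  have h2 := sqrt_constB_pos hε hθ
  have : 2 * √(constB ε θ) * (g11 ε θ + g33 ε θ - 1) = 0 := by linear_combination h + h1
  rcases mul_eq_zero.1 this with h3 | h3 <;> linarith

theorem g33_pos (hε : 0 < ε) (hθ : θ ∈ Set.Ico 0 (Real.pi / 2)) : 0 < g33 ε θ := by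
  have h := g33_eq hε hθ
  have h1 := mul_pos hε (cos_pos_of_mem hθ)
  have h2 := sqrt_constB_pos hε hθ
  exact pos_of_mul_pos_right (by rw [h]; linarith) (show 0 ≤ 2 * √(constB ε θ) by linarith)

/-- Strictness comes from `B = (ε cos θ)² + sin² θ`. For `θ = 0` the constant vanishes and the torus
degenerates, so in the direct part positivity has to come from the existence of a surface. -/
theorem g11_pos (hε : 0 < ε) (hθ : θ ∈ Set.Ico 0 (Real.pi / 2)) (hs : Real.sin θ ≠ 0) :
    0 < g11 ε θ := by
  have h := g11_eq hε hθ
  have h2 := sqrt_constB_pos hε hθ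
  have h1 : ε * Real.cos θ < √(constB ε θ) := by
    apply Real.lt_sqrt_of_sq_lt
    rw [constB_eq]
    have : 0 < Real.sin θ ^ 2 := by positivity
    linarith
  exact pos_of_mul_pos_right (by rw [h]; linarith) (show 0 ≤ 2 * √(constB ε θ) by linarith)

theorem torus_subset_sphere (hε : 0 < ε) (hθ : θ ∈ Set.Ico 0 (Real.pi / 2)) :
    torus √(g11 ε θ) √(g33 ε θ) ⊆ Metric.sphere (0 : R4) 1 := by
  rintro x ⟨h1, h2⟩
  rw [Real.sq_sqrt (g11_nonneg hε hθ)] at h1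
  rw [Real.sq_sqrt (g33_nonneg hε hθ)] at h2
  rw [mem_sphere_iff]
  linarith [g11_add_g33 hε hθ]

/-! ### The curve `β` -/

/-- The velocity of `β`. -/
noncomputable def betaVel (ε θ u : ℝ) : R4 :=
  !₂[-alpha1 ε θ * beta ε θ u 1, alpha1 ε θ * beta ε θ u 0,
    -alpha2 ε θ * beta ε θ u 3, alpha2 ε θ * beta ε θ u 2]

theorem hasDerivAt_R4 {c : ℝ → R4} {c' : R4} {t : ℝ} :
    HasDerivAt c c' t ↔ ∀ i, HasDerivAt (fun s => c s i) (c' i) t := by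
  simp only [← hasDerivWithinAt_univ, hasDerivWithinAt_iff_hasFDerivWithinAt,
    hasFDerivWithinAt_euclidean]
  refine forall_congr' fun i => Eq.to_iff ?_
  congr 1

theorem hasDerivAt_beta (u : ℝ) : HasDerivAt (beta ε θ) (betaVel ε θ u) u := by
  rw [hasDerivAt_R4]
  have h1 : HasDerivAt (fun t => alpha1 ε θ * t) (alpha1 ε θ) u := by
    simpa using (hasDerivAt_id u).const_mul (alpha1 ε θ)
  have h2 : HasDerivAt (fun t => alpha2 ε θ * t) (alpha2 ε θ) u := by
    simpa using (hasDerivAt_id u).const_mul (alpha2 ε θ)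
  intro i
  fin_cases i
  · exact (h1.cos.const_mul √(g11 ε θ)).congr_deriv (by simp [betaVel, beta]; ring)
  · exact (h1.sin.const_mul √(g11 ε θ)).congr_deriv (by simp [betaVel, beta]; ring)
  · exact (h2.cos.const_mul √(g33 ε θ)).congr_deriv (by simp [betaVel, beta]; ring)
  · exact (h2.sin.const_mul √(g33 ε θ)).congr_deriv (by simp [betaVel, beta]; ring)

theorem contDiff_beta : ContDiff ℝ ∞ (beta ε θ) := by
  rw [contDiff_euclidean]
  intro i
  fin_cases i <;> simp [beta] <;> fun_prop

theorem beta_sq01 (hε : 0 < ε) (hθ : θ ∈ Set.Ico 0 (Real.pi / 2)) (u : ℝ) :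
    beta ε θ u 0 ^ 2 + beta ε θ u 1 ^ 2 = g11 ε θ := by
  have h := Real.cos_sq_add_sin_sq (alpha1 ε θ * u)
  have h2 := Real.sq_sqrt (g11_nonneg hε hθ)
  simp [beta]
  linear_combination h2 + √(g11 ε θ) ^ 2 * h

theorem beta_sq23 (hε : 0 < ε) (hθ : θ ∈ Set.Ico 0 (Real.pi / 2)) (u : ℝ) :
    beta ε θ u 2 ^ 2 + beta ε θ u 3 ^ 2 = g33 ε θ := by
  have h := Real.cos_sq_add_sin_sq (alpha2 ε θ * u)
  have h2 := Real.sq_sqrt (g33_nonneg hε hθ)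
  simp [beta]
  linear_combination h2 + √(g33 ε θ) ^ 2 * h

/-- On each circle factor `β` moves uniformly, so its acceleration is `-αᵢ²` times the radial part.
Differentiating the two equations of the torus shows that every tangent vector is orthogonal to both
radial parts. -/
theorem isGeodesicOf_beta (hε : 0 < ε) (hθ : θ ∈ Set.Ico 0 (Real.pi / 2)) :
    IsGeodesicOf (torus √(g11 ε θ) √(g33 ε θ)) (beta ε θ) := by
  refine ⟨contDiff_beta, fun t => ⟨?_, ?_⟩, ?_⟩
  · rw [beta_sq01 hε hθ, Real.sq_sqrt (g11_nonneg hε hθ)]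
  · rw [beta_sq23 hε hθ, Real.sq_sqrt (g33_nonneg hε hθ)]
  rintro t w ⟨c, hc, hmem, h0, rfl⟩
  have hb : deriv (beta ε θ) = betaVel ε θ := funext fun u => (hasDerivAt_beta u).deriv
  have hb2 : HasDerivAt (betaVel ε θ) !₂[-alpha1 ε θ * betaVel ε θ t 1,
      alpha1 ε θ * betaVel ε θ t 0, -alpha2 ε θ * betaVel ε θ t 3,
      alpha2 ε θ * betaVel ε θ t 2] t := by
    have h := hasDerivAt_R4.1 (hasDerivAt_beta (ε := ε) (θ := θ) t)
    rw [hasDerivAt_R4]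
    intro i
    fin_cases i
    · exact (h 1).const_mul _
    · exact (h 0).const_mul _
    · exact (h 3).const_mul _
    · exact (h 2).const_mul _
  rw [hb, hb2.deriv]
  have hd := hasDerivAt_R4.1 (hc.differentiableAt (by simp)).hasDerivAt
  have e1 := ((hd 0).pow 2).add ((hd 1).pow 2)
  have e2 := ((hd 2).pow 2).add ((hd 3).pow 2)
  have k1 := e1.unique ((hasDerivAt_const (0 : ℝ) (√(g11 ε θ) ^ 2)).congr_of_eventuallyEq
    (hmem.mono fun t ht => ht.1))
  have k2 := e2.unique ((hasDerivAt_const (0 : ℝ) (√(g33 ε θ) ^ 2)).congr_of_eventuallyEq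
    (hmem.mono fun t ht => ht.2))
  rw [h0] at k1 k2
  norm_num at k1 k2
  rw [inner_R4]
  simp [betaVel]
  linear_combination -alpha1 ε θ ^ 2 / 2 * k1 - alpha2 ε θ ^ 2 / 2 * k2

end Constants

/-! ### Identities for the matrices `A` -/

theorem inner_rowsApply (k : ℝ) (r x y : R4) :
    inner ℝ (rowsApply k r x) (rowsApply k r y) = inner ℝ r r * inner ℝ x y := by
  have hk := Real.cos_sq_add_sin_sq k
  simp only [inner_R4]
  simp [rowsApply]
  linear_combination
    ((-r 3 * x 0 - r 2 * x 1 + r 1 * x 2 + r 0 * x 3) *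
      (-r 3 * y 0 - r 2 * y 1 + r 1 * y 2 + r 0 * y 3) +
    (-r 2 * x 0 + r 3 * x 1 + r 0 * x 2 - r 1 * x 3) *
      (-r 2 * y 0 + r 3 * y 1 + r 0 * y 2 - r 1 * y 3)) * hk

theorem hopfField_rowsApply (k : ℝ) (r x : R4) :
    hopfField (rowsApply k r x) = rowsApply k r (hopfField x) := by
  simp only [hopfField_eq]
  ext i
  fin_cases i <;> simp [rowsApply] <;> ring

theorem inner_hopfField_self (x : R4) : inner ℝ x (hopfField x) = 0 := by
  rw [inner_R4, hopfField_eq]; simp; ring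

theorem inner_hopfField_hopfField (x y : R4) :
    inner ℝ (hopfField x) (hopfField y) = inner ℝ x y := by
  simp only [inner_R4, hopfField_eq]; simp; ring

/-- The map `σ(z, w) = (iz, -iw)` commutes with `J₁, J₂, J₃`, so it is a quaternion unit acting from
the other side. Up to the rotation by `k`, which drops out, `A(r)ᵀ A(r')` is a combination of the
identity and such units. Pairing with `σx` picks out one coefficient, the expression that vanishes
in the admissibility equation. -/
theorem inner_rowsApply_conj (k : ℝ) (r r' x : R4) :
    inner ℝ (rowsApply k r' x) (rowsApply k r !₂[-x 1, x 0, x 3, -x 2]) =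
      (r 1 * r' 0 - r 0 * r' 1 - (r 3 * r' 2 - r 2 * r' 3)) * inner ℝ x x := by
  have hk := Real.cos_sq_add_sin_sq k
  simp only [inner_R4]
  simp [rowsApply]
  linear_combination
    ((-r' 3 * x 0 - r' 2 * x 1 + r' 1 * x 2 + r' 0 * x 3) *
      (r 3 * x 1 - r 2 * x 0 + r 1 * x 3 - r 0 * x 2) +
    (-r' 2 * x 0 + r' 3 * x 1 + r' 0 * x 2 - r' 1 * x 3) *
      (r 2 * x 1 + r 3 * x 0 + r 0 * x 3 + r 1 * x 2)) * hk

section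

variable {ε θ : ℝ}

theorem inner_beta (hε : 0 < ε) (hθ : θ ∈ Set.Ico 0 (Real.pi / 2)) (u : ℝ) :
    inner ℝ (beta ε θ u) (beta ε θ u) = 1 := by
  rw [inner_R4]
  linear_combination beta_sq01 hε hθ u + beta_sq23 hε hθ u + g11_add_g33 hε hθ

theorem inner_beta_betaVel (u : ℝ) : inner ℝ (beta ε θ u) (betaVel ε θ u) = 0 := by
  rw [inner_R4]; simp [betaVel]; ring

theorem inner_betaVel_hopfField (hε : 0 < ε) (hθ : θ ∈ Set.Ico 0 (Real.pi / 2)) (u : ℝ) :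
    ε * inner ℝ (betaVel ε θ u) (hopfField (beta ε θ u)) = Real.sin θ ^ 2 := by
  have e : inner ℝ (betaVel ε θ u) (hopfField (beta ε θ u)) =
      alpha1 ε θ * g11 ε θ + alpha2 ε θ * g33 ε θ := by
    rw [← beta_sq01 hε hθ u, ← beta_sq23 hε hθ u, inner_R4, hopfField_eq]; simp [betaVel]; ring
  have hb := sqrt_constB_pos hε hθ
  rw [e]
  apply mul_left_cancel₀ (mul_pos two_pos hb).ne'
  set b := √(constB ε θ)
  linear_combination 2 * b * g11 ε θ * alpha1_eq hε hθ + 2 * b * g33 ε θ * alpha2_eq hε hθ +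
    b * (b + ε * Real.cos θ) * g11_eq hε hθ + b * (b - ε * Real.cos θ) * g33_eq hε hθ +
    2 * b * sq_sqrt_constB hε hθ

theorem inner_betaVel (hε : 0 < ε) (hθ : θ ∈ Set.Ico 0 (Real.pi / 2)) (u : ℝ) :
    ε ^ 2 * inner ℝ (betaVel ε θ u) (betaVel ε θ u) = constB ε θ * Real.sin θ ^ 2 := by
  have e : inner ℝ (betaVel ε θ u) (betaVel ε θ u) =
      alpha1 ε θ ^ 2 * g11 ε θ + alpha2 ε θ ^ 2 * g33 ε θ := by
    rw [← beta_sq01 hε hθ u, ← beta_sq23 hε hθ u, inner_R4]; simp [betaVel]; ring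
  have hb := sqrt_constB_pos hε hθ
  have hB := Real.sq_sqrt (constB_pos hε hθ).le
  have h1 := alpha1_eq hε hθ
  have h2 := alpha2_eq hε hθ
  have e1 : ε ^ 2 * (alpha1 ε θ ^ 2 * g11 ε θ + alpha2 ε θ ^ 2 * g33 ε θ) =
      (ε * alpha1 ε θ) ^ 2 * g11 ε θ + (ε * alpha2 ε θ) ^ 2 * g33 ε θ := by ring
  rw [e, e1, h1, h2]
  apply mul_left_cancel₀ (mul_pos two_pos hb).ne'
  set b := √(constB ε θ)
  rw [← hB]
  linear_combination (b * (b + ε * Real.cos θ)) ^ 2 * g11_eq hε hθ +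
    (b * (b - ε * Real.cos θ)) ^ 2 * g33_eq hε hθ + 2 * b ^ 3 * sq_sqrt_constB hε hθ

theorem betaVel_eq (hε : 0 < ε) (hθ : θ ∈ Set.Ico 0 (Real.pi / 2)) (u : ℝ) :
    ε • betaVel ε θ u = constB ε θ • hopfField (beta ε θ u) +
      (√(constB ε θ) * (ε * Real.cos θ)) •
        !₂[-beta ε θ u 1, beta ε θ u 0, beta ε θ u 3, -beta ε θ u 2] := by
  have hB := Real.sq_sqrt (constB_pos hε hθ).le
  have h1 := alpha1_eq hε hθ
  have h2 := alpha2_eq hε hθ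
  rw [hopfField_eq]
  ext i
  fin_cases i <;> simp [betaVel]
  · linear_combination (-beta ε θ u 1) * (h1 + hB)
  · linear_combination (beta ε θ u 0) * (h1 + hB)
  · linear_combination (-beta ε θ u 3) * (h2 + hB)
  · linear_combination (beta ε θ u 2) * (h2 + hB)

/-- Along `A β`, the difference `E₁ - A β'` is orthogonal to `A β'` and to `A' β`. -/
theorem bergerMetric_rowsApply (hε : 0 < ε) (hθ : θ ∈ Set.Ico 0 (Real.pi / 2)) (k u : ℝ)
    {r r' : R4} (hr : inner ℝ r r = 1)
    (hode : r 0 * r' 1 - r 1 * r' 0 = r 2 * r' 3 - r 3 * r' 2) (s t : ℝ) :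
    bergerMetric ε (rowsApply k r (beta ε θ u))
      (ε⁻¹ • hopfField (rowsApply k r (beta ε θ u)) - rowsApply k r (betaVel ε θ u))
      (s • rowsApply k r (betaVel ε θ u) + t • rowsApply k r' (beta ε θ u)) = 0 := by
  have h1 := inner_betaVel_hopfField hε hθ u
  have h2 := inner_betaVel hε hθ u
  have h3 := inner_beta hε hθ u
  have hc := Real.sin_sq_add_cos_sq θ
  have hB : constB ε θ = 1 + (ε ^ 2 - 1) * Real.cos θ ^ 2 := rfl
  -- The differential equation kills the `σβ` part of `β'`, so against `A'β` only its Hopf part is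
  -- seen.
  have h4 : ε * inner ℝ (rowsApply k r' (beta ε θ u)) (rowsApply k r (betaVel ε θ u)) =
      constB ε θ * inner ℝ (rowsApply k r' (beta ε θ u))
        (rowsApply k r (hopfField (beta ε θ u))) := by
    have h := inner_rowsApply_conj k r r' (beta ε θ u)
    simp only [← rowsApplyL_apply] at h ⊢
    rw [← real_inner_smul_right, ← map_smul, betaVel_eq hε hθ, map_add, map_smul, map_smul,
      inner_add_right, real_inner_smul_right, real_inner_smul_right, h]
    linear_combination (-√(constB ε θ) * (ε * Real.cos θ)) *
      inner ℝ (beta ε θ u) (beta ε θ u) * hode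
  rw [hopfField_rowsApply, bergerMetric]
  simp only [hopfField_rowsApply, inner_sub_left, inner_add_left, inner_add_right, inner_smul_left,
    inner_smul_right, inner_rowsApply, inner_hopfField_hopfField, hr, h3, RCLike.conj_to_real]
  rw [real_inner_comm _ (hopfField (beta ε θ u)),
    real_inner_comm (rowsApply k r' (beta ε θ u)) (rowsApply k r (betaVel ε θ u)),
    real_inner_comm (rowsApply k r' (beta ε θ u)) (rowsApply k r (hopfField (beta ε θ u)))]
  generalize inner ℝ (rowsApply k r' (beta ε θ u)) (rowsApply k r (betaVel ε θ u)) = p at *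
  generalize inner ℝ (rowsApply k r' (beta ε θ u)) (rowsApply k r (hopfField (beta ε θ u))) = q at *
  generalize inner ℝ (betaVel ε θ u) (hopfField (beta ε θ u)) = m at *
  generalize inner ℝ (betaVel ε θ u) (betaVel ε θ u) = n at *
  have hp : p = ε⁻¹ * (constB ε θ * q) := by rw [← h4]; field_simp
  have hm : m = ε⁻¹ * Real.sin θ ^ 2 := by rw [← h1]; field_simp
  have hn : n = ε⁻¹ ^ 2 * (constB ε θ * Real.sin θ ^ 2) := by rw [← h2]; field_simp
  rw [hp, hm, hn, hB]
  field_simp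
  rw [Real.sin_sq]
  ring

theorem bergerMetric_normal_part (hε : 0 < ε) (hθ : θ ∈ Set.Ico 0 (Real.pi / 2)) (k u : ℝ)
    {r : R4} (hr : inner ℝ r r = 1) :
    bergerMetric ε (rowsApply k r (beta ε θ u))
      (ε⁻¹ • hopfField (rowsApply k r (beta ε θ u)) - rowsApply k r (betaVel ε θ u))
      (ε⁻¹ • hopfField (rowsApply k r (beta ε θ u)) - rowsApply k r (betaVel ε θ u))
      = Real.cos θ ^ 2 := by
  have h1 := inner_betaVel_hopfField hε hθ u
  have h2 := inner_betaVel hε hθ u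
  have h3 := inner_beta hε hθ u
  have hc := Real.sin_sq_add_cos_sq θ
  have hB : constB ε θ = 1 + (ε ^ 2 - 1) * Real.cos θ ^ 2 := rfl
  rw [hopfField_rowsApply, bergerMetric]
  simp only [hopfField_rowsApply, inner_sub_left, inner_sub_right, inner_smul_left,
    inner_smul_right, inner_rowsApply, inner_hopfField_hopfField, hr, h3, RCLike.conj_to_real]
  rw [real_inner_comm _ (hopfField (beta ε θ u))]
  generalize inner ℝ (betaVel ε θ u) (hopfField (beta ε θ u)) = m at *
  generalize inner ℝ (betaVel ε θ u) (betaVel ε θ u) = n at *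
  have hm : m = ε⁻¹ * Real.sin θ ^ 2 := by rw [← h1]; field_simp
  have hn : n = ε⁻¹ ^ 2 * (constB ε θ * Real.sin θ ^ 2) := by rw [← h2]; field_simp
  rw [hm, hn, hB]
  field_simp
  rw [Real.sin_sq]
  ring

/-- If the tangential part `X` of `E₁` has been found, the angle of a unit normal with `X₁` is
determined by the length of `E₁ - X`. -/
theorem angle_of_normal_part (hε : 0 < ε) {c : ℝ} (hc : 0 ≤ c) {p X Y n : R4}
    (hp : inner ℝ p p = 1) (hX : inner ℝ p X = 0) (hY : inner ℝ p Y = 0)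
    (hind : ∀ a b : ℝ, a • X + b • Y = 0 → a = 0 ∧ b = 0)
    (hEX : bergerMetric ε p (ε⁻¹ • hopfField p - X) X = 0)
    (hEY : bergerMetric ε p (ε⁻¹ • hopfField p - X) Y = 0)
    (hEE : bergerMetric ε p (ε⁻¹ • hopfField p - X) (ε⁻¹ • hopfField p - X) = c ^ 2)
    (hn : inner ℝ p n = 0) (hnX : bergerMetric ε p n X = 0) (hnY : bergerMetric ε p n Y = 0)
    (hnn : bergerMetric ε p n n = 1) :
    |bergerMetric ε p (hopfField p) n| = ε * c := by
  set E := ε⁻¹ • hopfField p - X with hE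
  have hpE : inner ℝ p E = 0 := by
    rw [hE, inner_sub_right, real_inner_smul_right, inner_hopfField_self, hX]; simp
  -- `G` turns the Berger product into the Euclidean one. It sends vectors `g_ε`-normal to the
  -- surface into the Euclidean complement of `p, X, Y`, which is a line in `ℝ⁴`. So `G E` is a
  -- multiple of `G n`.
  let G : R4 → R4 := fun Z => Z + ((ε ^ 2 - 1) * inner ℝ Z (hopfField p)) • hopfField p
  have hG : ∀ Z W, inner ℝ W (G Z) = bergerMetric ε p Z W := fun Z W => by
    simp only [G, bergerMetric, inner_add_right, real_inner_smul_right]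
    rw [real_inner_comm Z W]
  have hGp : ∀ Z, inner ℝ p Z = 0 → inner ℝ p (G Z) = 0 := fun Z hZ => by
    simp only [G, inner_add_right, real_inner_smul_right, inner_hopfField_self, hZ]; simp
  have hli : LinearIndependent ℝ ![p, X, Y] := by
    rw [Fintype.linearIndependent_iff]
    intro g hg
    simp [Fin.sum_univ_three] at hg
    have h0 : g 0 = 0 := by
      have := congrArg (fun Z => inner ℝ p Z) hg
      simp only [inner_add_right, real_inner_smul_right, hp, hX, hY, inner_zero_right] at this
      linarith
    rw [h0] at hg
    have := hind (g 1) (g 2) (by simpa using hg)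
    intro i; fin_cases i
    exacts [h0, this.1, this.2]
  set K := Submodule.span ℝ (Set.range ![p, X, Y]) with hK
  have hmem : ∀ Z, inner ℝ p Z = 0 → bergerMetric ε p Z X = 0 → bergerMetric ε p Z Y = 0 →
      G Z ∈ Kᗮ := by
    intro Z h0 h1 h2
    rw [hK, Submodule.mem_orthogonal]
    intro w hw
    induction hw using Submodule.span_induction with
    | mem x h =>
      obtain ⟨i, rfl⟩ := h
      fin_cases i
      · exact hGp Z h0
      · exact (hG Z X).trans h1
      · exact (hG Z Y).trans h2
    | zero => simp
    | add x y _ _ hx hy => rw [inner_add_left, hx, hy, add_zero]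
    | smul a x _ hx => rw [inner_smul_left, hx, mul_zero]
  have hrank : Module.finrank ℝ Kᗮ = 1 := by
    have h1 := K.finrank_add_finrank_orthogonal
    have h2 : Module.finrank ℝ K = 3 := by
      rw [hK, finrank_span_eq_card hli]; simp
    rw [h2, finrank_euclideanSpace_fin] at h1
    omega
  have hGn0 : (⟨G n, hmem n hn hnX hnY⟩ : Kᗮ) ≠ 0 := by
    intro h
    have h' : G n = 0 := congrArg Subtype.val h
    have := hG n n
    rw [h', hnn] at this
    simp at this
  obtain ⟨t, ht⟩ := (finrank_eq_one_iff_of_nonzero' _ hGn0).1 hrank ⟨G E, hmem E hpE hEX hEY⟩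
  have ht' : t • G n = G E := congrArg Subtype.val ht
  have key : ∀ W, bergerMetric ε p E W = t * bergerMetric ε p n W := fun W => by
    rw [← hG, ← hG, ← ht', real_inner_smul_right]
  have hsymm : ∀ Z W, bergerMetric ε p Z W = bergerMetric ε p W Z := fun Z W => by
    simp only [bergerMetric]; rw [real_inner_comm]; ring
  have h1 : bergerMetric ε p E n = t := by rw [key, hnn, mul_one]
  have h2 : t ^ 2 = c ^ 2 := by rw [← hEE, key, hsymm, h1, sq]
  have h3 : bergerMetric ε p (hopfField p) n = ε * t := by
    have : bergerMetric ε p E n = ε⁻¹ * bergerMetric ε p (hopfField p) n - bergerMetric ε p n X := by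
      rw [hsymm n X, hE]
      simp only [bergerMetric, inner_sub_left, real_inner_smul_left]
      ring
    rw [hnX, h1, sub_zero] at this
    rw [this]; field_simp
  rw [h3, abs_mul, abs_of_pos hε, ← abs_of_nonneg hc, (sq_eq_sq_iff_abs_eq_abs t c).1 h2]

/-! ### The map `F(u, v) = A(v) β(u)` -/

theorem row1_sq (a b c : ℝ) :
    inner ℝ (WithLp.toLp 2 (row1 a b c) : R4) (WithLp.toLp 2 (row1 a b c)) = 1 := by
  rw [inner_R4]
  simp [row1]
  linear_combination Real.cos a ^ 2 * Real.cos_sq_add_sin_sq b +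
    Real.sin a ^ 2 * Real.cos_sq_add_sin_sq c + Real.cos_sq_add_sin_sq a

theorem helixMap_eq (ξ ξ₁ ξ₂ ξ₃ : ℝ → ℝ) (x : R2) :
    helixMap ε θ ξ ξ₁ ξ₂ ξ₃ x =
      rowsApply (ξ (x 1)) (WithLp.toLp 2 (row1 (ξ₁ (x 1)) (ξ₂ (x 1)) (ξ₃ (x 1))))
        (beta ε θ (x 0)) := act_matA _ _ _ _ _

theorem hasFDerivAt_coord (i : Fin 2) (x : R2) :
    HasFDerivAt (fun y : R2 => y i) (EuclideanSpace.proj i : R2 →L[ℝ] ℝ) x :=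
  (EuclideanSpace.proj i : R2 →L[ℝ] ℝ).hasFDerivAt

theorem fderiv_rowsApply {k : ℝ} {γ : ℝ → R4} {r' : R4} {x : R2} (h : HasDerivAt γ r' (x 1)) :
    ∃ L : R2 →L[ℝ] R4, HasFDerivAt (fun y : R2 => rowsApply k (γ (y 1)) (beta ε θ (y 0))) L x ∧
      ∀ w, L w = w 0 • rowsApply k (γ (x 1)) (betaVel ε θ (x 0)) +
        w 1 • rowsApply k r' (beta ε θ (x 0)) := by
  have h1 := h.hasFDerivAt.comp x (hasFDerivAt_coord 1 x)
  have h2 := (hasDerivAt_beta (ε := ε) (θ := θ) (x 0)).hasFDerivAt.comp x (hasFDerivAt_coord 0 x)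
  refine ⟨_, (rowsApplyL k).hasFDerivAt_of_bilinear h1 h2, fun w => ?_⟩
  simp [← rowsApplyL_apply]

/-- The velocity of the curve of first rows. -/
noncomputable def row1Vel (a b c a' b' c' : ℝ) : R4 :=
  !₂[-Real.sin a * a' * Real.cos b + Real.cos a * (-Real.sin b * b'),
    -(-Real.sin a * a' * Real.sin b + Real.cos a * (Real.cos b * b')),
    Real.cos a * a' * Real.cos c + Real.sin a * (-Real.sin c * c'),
    -(Real.cos a * a' * Real.sin c + Real.sin a * (Real.cos c * c'))]

theorem hasDerivAt_row1 {ξ₁ ξ₂ ξ₃ : ℝ → ℝ} {a' b' c' v : ℝ} (h₁ : HasDerivAt ξ₁ a' v)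
    (h₂ : HasDerivAt ξ₂ b' v) (h₃ : HasDerivAt ξ₃ c' v) :
    HasDerivAt (fun v => (WithLp.toLp 2 (row1 (ξ₁ v) (ξ₂ v) (ξ₃ v)) : R4))
      (row1Vel (ξ₁ v) (ξ₂ v) (ξ₃ v) a' b' c') v := by
  rw [hasDerivAt_R4]
  intro i
  fin_cases i
  · exact h₁.cos.mul h₂.cos
  · exact (h₁.cos.mul h₂.sin).neg
  · exact h₁.sin.mul h₃.cos
  · exact (h₁.sin.mul h₃.sin).neg

theorem inner_row1_row1Vel (a b c a' b' c' : ℝ) :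
    inner ℝ (WithLp.toLp 2 (row1 a b c) : R4) (row1Vel a b c a' b' c') = 0 := by
  have h2 := Real.cos_sq_add_sin_sq b
  have h3 := Real.cos_sq_add_sin_sq c
  rw [inner_R4]
  simp [row1, row1Vel]
  linear_combination (-Real.cos a * Real.sin a * a') * (h2 - h3)

/-- Identifies the admissibility equation with the condition on the first row and its velocity under
which `A'β ⊥ A σβ`. -/
theorem row1_wedge_row1Vel (a b c a' b' c' : ℝ) :
    (row1 a b c 0 * row1Vel a b c a' b' c' 1 - row1 a b c 1 * row1Vel a b c a' b' c' 0) -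
      (row1 a b c 2 * row1Vel a b c a' b' c' 3 - row1 a b c 3 * row1Vel a b c a' b' c' 2) =
    -(Real.cos a ^ 2 * b' - Real.sin a ^ 2 * c') := by
  have h2 := Real.cos_sq_add_sin_sq b
  have h3 := Real.cos_sq_add_sin_sq c
  simp [row1, row1Vel]
  linear_combination (-Real.cos a ^ 2 * b') * h2 + (Real.sin a ^ 2 * c') * h3

/-- Constancy of `ξ` makes `F` bilinear in the first row and `β`, so the product rule leaves only `A
β'` and `A' β`, with `A'` again of the form given by `r'`. -/
theorem IsAdmissible.exists_fderiv {I : Set ℝ} {ξ ξ₁ ξ₂ ξ₃ : ℝ → ℝ}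
    (h : IsAdmissible I ξ ξ₁ ξ₂ ξ₃) (hI : IsOpen I) {x : R2} (hx : x 1 ∈ I) :
    ∃ (k : ℝ) (r r' : R4), inner ℝ r r = 1 ∧ inner ℝ r r' = 0 ∧
      r 0 * r' 1 - r 1 * r' 0 = r 2 * r' 3 - r 3 * r' 2 ∧
      helixMap ε θ ξ ξ₁ ξ₂ ξ₃ x = rowsApply k r (beta ε θ (x 0)) ∧
      DifferentiableAt ℝ (helixMap ε θ ξ ξ₁ ξ₂ ξ₃) x ∧
      ∀ w, fderiv ℝ (helixMap ε θ ξ ξ₁ ξ₂ ξ₃) x w =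
        w 0 • rowsApply k r (betaVel ε θ (x 0)) + w 1 • rowsApply k r' (beta ε θ (x 0)) := by
  obtain ⟨k, hk⟩ := h.const
  have hd : ∀ {g : ℝ → ℝ}, ContDiffOn ℝ ∞ g I → HasDerivAt g (deriv g (x 1)) (x 1) := fun hg =>
    ((hg.contDiffAt (hI.mem_nhds hx)).differentiableAt (by simp)).hasDerivAt
  have d1 := hd h.smooth₁
  have d2 := hd h.smooth₂
  have d3 := hd h.smooth₃
  have ode := h.ode _ hx
  have hγ := hasDerivAt_row1 d1 d2 d3
  obtain ⟨L, hL, hLw⟩ := fderiv_rowsApply (ε := ε) (θ := θ) (k := k) hγ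
  have hev : helixMap ε θ ξ ξ₁ ξ₂ ξ₃ =ᶠ[nhds x]
      fun y : R2 => rowsApply k (WithLp.toLp 2 (row1 (ξ₁ (y 1)) (ξ₂ (y 1)) (ξ₃ (y 1))))
        (beta ε θ (y 0)) := by
    have : ∀ᶠ y : R2 in nhds x, y 1 ∈ I :=
      (hasFDerivAt_coord 1 x).continuousAt.eventually (hI.mem_nhds hx)
    filter_upwards [this] with y hy
    rw [helixMap_eq, hk _ hy]
  have hL' := hL.congr_of_eventuallyEq hev
  refine ⟨k, _, _, row1_sq (ξ₁ (x 1)) (ξ₂ (x 1)) (ξ₃ (x 1)), inner_row1_row1Vel _ _ _ _ _ _, ?_,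
    hev.eq_of_nhds, hL'.differentiableAt, fun w => by rw [hL'.fderiv, hLw]⟩
  have := row1_wedge_row1Vel (ξ₁ (x 1)) (ξ₂ (x 1)) (ξ₃ (x 1)) (deriv ξ₁ (x 1)) (deriv ξ₂ (x 1))
    (deriv ξ₃ (x 1))
  rw [ode] at this
  linarith

theorem IsAdmissible.contDiffOn_helixMap {I : Set ℝ} {ξ ξ₁ ξ₂ ξ₃ : ℝ → ℝ}
    (h : IsAdmissible I ξ ξ₁ ξ₂ ξ₃) :
    ContDiffOn ℝ ∞ (helixMap ε θ ξ ξ₁ ξ₂ ξ₃) {x | x 1 ∈ I} := by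
  have hc : ∀ i, ContDiff ℝ ∞ fun y : R2 => y i := fun i =>
    (EuclideanSpace.proj i : R2 →L[ℝ] ℝ).contDiff
  have hm : Set.MapsTo (fun y : R2 => y 1) {x | x 1 ∈ I} I := fun x hx => hx
  have h0 := h.smooth.comp (hc 1).contDiffOn hm
  have h1 := h.smooth₁.comp (hc 1).contDiffOn hm
  have h2 := h.smooth₂.comp (hc 1).contDiffOn hm
  have h3 := h.smooth₃.comp (hc 1).contDiffOn hm
  have hb : ∀ i, ContDiffOn ℝ ∞ (fun y : R2 => beta ε θ (y 0) i) {x : R2 | x 1 ∈ I} := fun i =>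
    ((contDiff_euclidean.1 contDiff_beta i).comp (hc 0)).contDiffOn
  have c0 := Real.contDiff_cos.comp_contDiffOn h0
  have s0 := Real.contDiff_sin.comp_contDiffOn h0
  have c1 := Real.contDiff_cos.comp_contDiffOn h1
  have s1 := Real.contDiff_sin.comp_contDiffOn h1
  have c2 := Real.contDiff_cos.comp_contDiffOn h2
  have s2 := Real.contDiff_sin.comp_contDiffOn h2
  have c3 := Real.contDiff_cos.comp_contDiffOn h3
  have s3 := Real.contDiff_sin.comp_contDiffOn h3
  have b0 := hb 0
  have b1 := hb 1
  have b2 := hb 2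
  have b3 := hb 3
  simp only [Function.comp_def] at c0 s0 c1 s1 c2 s2 c3 s3
  rw [contDiffOn_euclidean]
  intro i
  fin_cases i <;> simp [helixMap_eq, rowsApply, row1] <;> fun_prop

theorem IsAdmissible.hopf_tangent_part (hε : 0 < ε) (hθ : θ ∈ Set.Ico 0 (Real.pi / 2))
    {I : Set ℝ} {ξ ξ₁ ξ₂ ξ₃ : ℝ → ℝ}
    (h : IsAdmissible I ξ ξ₁ ξ₂ ξ₃) (hI : IsOpen I) {x : R2} (hx : x 1 ∈ I) (w : R2) :
    bergerMetric ε (helixMap ε θ ξ ξ₁ ξ₂ ξ₃ x)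
      (ε⁻¹ • hopfField (helixMap ε θ ξ ξ₁ ξ₂ ξ₃ x) -
        fderiv ℝ (helixMap ε θ ξ ξ₁ ξ₂ ξ₃) x (EuclideanSpace.single 0 1))
      (fderiv ℝ (helixMap ε θ ξ ξ₁ ξ₂ ξ₃) x w) = 0 := by
  obtain ⟨k, r, r', hr, -, hode, hF, -, hL⟩ := h.exists_fderiv (ε := ε) (θ := θ) hI hx
  rw [hL, hL, hF]
  simpa using bergerMetric_rowsApply hε hθ k (x 0) hr hode (w 0) (w 1)

theorem IsAdmissible.angle (hε : 0 < ε) (hθ : θ ∈ Set.Ico 0 (Real.pi / 2))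
    {I : Set ℝ} {ξ ξ₁ ξ₂ ξ₃ : ℝ → ℝ}
    (h : IsAdmissible I ξ ξ₁ ξ₂ ξ₃) (hI : IsOpen I) {x : R2} (hx : x 1 ∈ I)
    (hinj : Function.Injective (fderiv ℝ (helixMap ε θ ξ ξ₁ ξ₂ ξ₃) x)) {n : R4}
    (hn : inner ℝ (helixMap ε θ ξ ξ₁ ξ₂ ξ₃ x) n = 0)
    (hnT : ∀ w, bergerMetric ε (helixMap ε θ ξ ξ₁ ξ₂ ξ₃ x) n
      (fderiv ℝ (helixMap ε θ ξ ξ₁ ξ₂ ξ₃) x w) = 0)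
    (hnn : bergerMetric ε (helixMap ε θ ξ ξ₁ ξ₂ ξ₃ x) n n = 1) :
    |bergerMetric ε (helixMap ε θ ξ ξ₁ ξ₂ ξ₃ x) (hopfField (helixMap ε θ ξ ξ₁ ξ₂ ξ₃ x)) n| =
      ε * Real.cos θ := by
  obtain ⟨k, r, r', hr, hrr, hode, hF, -, hL⟩ := h.exists_fderiv (ε := ε) (θ := θ) hI hx
  rw [hF] at hn hnT hnn ⊢
  have hb := bergerMetric_rowsApply hε hθ k (x 0) hr hode
  have hX := hb 1 0
  have hY := hb 0 1
  simp only [one_smul, zero_smul, add_zero, zero_add] at hX hY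
  have hnX := hnT (EuclideanSpace.single 0 1)
  have hnY := hnT (EuclideanSpace.single 1 1)
  rw [hL] at hnX hnY
  refine angle_of_normal_part hε (cos_pos_of_mem hθ).le (X := rowsApply k r (betaVel ε θ (x 0)))
    (Y := rowsApply k r' (beta ε θ (x 0))) ?_ ?_ ?_ ?_ hX hY
    (bergerMetric_normal_part hε hθ k (x 0) hr) hn (by simpa using hnX) (by simpa using hnY) hnn
  · rw [inner_rowsApply, hr, inner_beta hε hθ, one_mul]
  · rw [inner_rowsApply, inner_beta_betaVel, mul_zero]
  · have hk := Real.cos_sq_add_sin_sq k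
    -- This is `inner_rowsApply` polarised in the first row.
    have : inner ℝ (rowsApply k r (beta ε θ (x 0))) (rowsApply k r' (beta ε θ (x 0))) =
        inner ℝ r r' * inner ℝ (beta ε θ (x 0)) (beta ε θ (x 0)) := by
      simp only [inner_R4]
      simp [rowsApply]
      generalize beta ε θ (x 0) = y
      linear_combination
        ((-r 3 * y 0 - r 2 * y 1 + r 1 * y 2 + r 0 * y 3) *
          (-r' 3 * y 0 - r' 2 * y 1 + r' 1 * y 2 + r' 0 * y 3) +
        (-r 2 * y 0 + r 3 * y 1 + r 0 * y 2 - r 1 * y 3) *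
          (-r' 2 * y 0 + r' 3 * y 1 + r' 0 * y 2 - r' 1 * y 3)) * hk
    rw [this, hrr, zero_mul]
  · intro a b hab
    have := hL !₂[a, b]
    simp only [PiLp.toLp_apply, Matrix.cons_val_zero, Matrix.cons_val_one] at this
    rw [hab] at this
    have h0 : (!₂[a, b] : R2) = 0 := hinj (by rw [this, map_zero])
    exact ⟨by simpa using congrArg (fun y : R2 => y 0) h0,
      by simpa using congrArg (fun y : R2 => y 1) h0⟩

end

/-! ### Smooth polar coordinates along a curve -/

section Hadamard

variable {E : Type*} [NormedAddCommGroup E] [NormedSpace ℝ E]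

/-- The weight `t ^ k` makes the family closed under differentiation: each derivative replaces `f`
by `f'` and raises the exponent. This drives the induction for smoothness. Domination is by the
maximum of `‖f'‖` on a compact interval. -/
theorem hasDerivAt_integral_dilation {f : ℝ → E} (hf : ContDiff ℝ ∞ f) (k : ℕ) (v : ℝ) :
    HasDerivAt (fun v : ℝ => ∫ t in (0 : ℝ)..1, t ^ k • f (t * v))
      (∫ t in (0 : ℝ)..1, t ^ (k + 1) • deriv f (t * v)) v := by
  have hf' : Continuous (deriv f) := hf.continuous_deriv (by simp)
  obtain ⟨C, hC⟩ := (isCompact_Icc (a := -(|v| + 1)) (b := |v| + 1)).exists_bound_of_continuousOn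
    hf'.continuousOn
  have hfc := hf.continuous
  refine (intervalIntegral.hasDerivAt_integral_of_dominated_loc_of_deriv_le
    (F := fun v t => t ^ k • f (t * v)) (F' := fun v t => t ^ (k + 1) • deriv f (t * v))
    (bound := fun _ => C) (Metric.ball_mem_nhds v one_pos) ?_ ?_ ?_ ?_ ?_ ?_).2
  · exact Filter.Eventually.of_forall fun x =>
      (by fun_prop : Continuous fun t : ℝ => t ^ k • f (t * x)).aestronglyMeasurable
  · exact (by fun_prop : Continuous fun t : ℝ => t ^ k • f (t * v)).intervalIntegrable _ _
  · exact (by fun_prop : Continuous fun t : ℝ =>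
      t ^ (k + 1) • deriv f (t * v)).aestronglyMeasurable
  · refine Filter.Eventually.of_forall fun t ht x hx => ?_
    rw [Set.uIoc_of_le zero_le_one] at ht
    have hx' : |x| ≤ |v| + 1 := by
      have h1 : |x - v| < 1 := hx
      have := abs_sub_abs_le_abs_sub x v
      linarith
    have htx : |t * x| ≤ |v| + 1 := by
      rw [abs_mul, abs_of_pos ht.1]
      nlinarith [abs_nonneg x, ht.2]
    have h1 := hC (t * x) (abs_le.1 htx)
    rw [norm_smul, norm_pow, Real.norm_eq_abs, abs_of_pos ht.1]
    calc t ^ (k + 1) * ‖deriv f (t * x)‖ ≤ 1 * ‖deriv f (t * x)‖ := by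
          gcongr; exact pow_le_one₀ ht.1.le ht.2
      _ ≤ C := by rwa [one_mul]
  · simp
  · refine Filter.Eventually.of_forall fun t _ x _ => ?_
    have h1 : HasDerivAt (fun x : ℝ => t * x) t x := by
      simpa using (hasDerivAt_id x).const_mul t
    have h2 := (hf.differentiable (by simp) (t * x)).hasDerivAt.scomp x h1
    have h3 := h2.const_smul (t ^ k)
    rwa [smul_smul, ← pow_succ] at h3

theorem contDiff_integral_dilation {f : ℝ → E} (hf : ContDiff ℝ ∞ f) (k : ℕ) :
    ContDiff ℝ ∞ (fun v : ℝ => ∫ t in (0 : ℝ)..1, t ^ k • f (t * v)) := by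
  rw [contDiff_infty]
  intro n
  induction n generalizing f k with
  | zero =>
    exact contDiff_zero.2 (continuous_iff_continuousAt.2 fun v =>
      (hasDerivAt_integral_dilation hf k v).continuousAt)
  | succ n ih =>
    push_cast
    rw [contDiff_succ_iff_deriv]
    refine ⟨fun v => (hasDerivAt_integral_dilation hf k v).differentiableAt, by simp, ?_⟩
    rw [show deriv (fun v : ℝ => ∫ t in (0 : ℝ)..1, t ^ k • f (t * v)) = _ from
      funext fun v => (hasDerivAt_integral_dilation hf k v).deriv]
    exact ih (contDiff_infty_iff_deriv.1 hf).2 (k + 1)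

/-- Hadamard's lemma on the line. -/
theorem exists_contDiff_eq_smul [CompleteSpace E] {f : ℝ → E} (hf : ContDiff ℝ ∞ f)
    (h0 : f 0 = 0) : ∃ g : ℝ → E, ContDiff ℝ ∞ g ∧ ∀ v, f v = v • g v := by
  refine ⟨_, contDiff_integral_dilation (contDiff_infty_iff_deriv.1 hf).2 0, fun v => ?_⟩
  have hf' : Continuous (deriv f) := hf.continuous_deriv (by simp)
  have h : ∀ t ∈ Set.uIcc (0 : ℝ) 1, HasDerivAt (fun t : ℝ => f (t * v)) (v • deriv f (t * v)) t :=
    fun t _ => (hf.differentiable (by simp) (t * v)).hasDerivAt.scomp t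
      (by simpa using (hasDerivAt_id t).mul_const v)
  have := intervalIntegral.integral_eq_sub_of_hasDerivAt h
    ((by fun_prop : Continuous fun t : ℝ => v • deriv f (t * v)).intervalIntegrable _ _)
  simp only [one_mul, zero_mul, h0, sub_zero, intervalIntegral.integral_smul] at this
  simp [← this]

/-- Cutting off by a bump function makes the global form of Hadamard's lemma applicable to a germ.
-/
theorem exists_contDiff_eventuallyEq {f : ℝ → E} {V : Set ℝ} {v₀ : ℝ} (hV : IsOpen V)
    (hv : v₀ ∈ V) (hf : ContDiffOn ℝ ∞ f V) :
    ∃ g : ℝ → E, ContDiff ℝ ∞ g ∧ g =ᶠ[nhds v₀] f := by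
  obtain ⟨δ, hδ, hball⟩ := Metric.isOpen_iff.1 hV v₀ hv
  let χ : ContDiffBump v₀ := ⟨δ / 4, δ / 2, by positivity, by linarith⟩
  refine ⟨fun v => χ v • f v, contDiff_iff_contDiffAt.2 fun x => ?_, ?_⟩
  · by_cases hx : x ∈ V
    · exact χ.contDiff.contDiffAt.smul (hf.contDiffAt (hV.mem_nhds hx))
    · have hx' : x ∉ tsupport χ := by
        rw [χ.tsupport_eq]
        intro h
        refine hx (hball (Metric.closedBall_subset_ball ?_ h))
        change δ / 2 < δ
        linarith
      have h2 : (χ : ℝ → ℝ) =ᶠ[nhds x] 0 := notMem_tsupport_iff_eventuallyEq.1 hx'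
      refine (contDiffAt_const (c := (0 : E))).congr_of_eventuallyEq ?_
      filter_upwards [h2] with y hy
      simp [hy]
  · filter_upwards [χ.eventuallyEq_one] with y hy
    simp [hy]

end Hadamard

/-- A smooth nowhere zero complex function is locally `‖h‖ exp (iη)`. -/
theorem exists_arg {E : Type*} [NormedAddCommGroup E] [NormedSpace ℝ E] {h : E → ℂ} {V : Set E}
    {x₀ : E} (hV : IsOpen V) (hx : x₀ ∈ V) (hh : ContDiffOn ℝ ∞ h V) (h0 : h x₀ ≠ 0) :
    ∃ (V' : Set E) (η : E → ℝ), IsOpen V' ∧ x₀ ∈ V' ∧ V' ⊆ V ∧ ContDiffOn ℝ ∞ η V' ∧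
      (∀ x ∈ V', h x ≠ 0) ∧ ∀ x ∈ V', h x = ‖h x‖ * Complex.exp (η x * Complex.I) := by
  -- Dividing by `h x₀` moves the value at `x₀` to `1`, inside the slit plane, where the principal
  -- logarithm is smooth.
  let q : E → ℂ := fun x => h x / h x₀
  have hq : ContDiffOn ℝ ∞ q V := hh.div_const _
  have hs : IsOpen (V ∩ q ⁻¹' Complex.slitPlane) :=
    hq.continuousOn.isOpen_inter_preimage hV Complex.isOpen_slitPlane
  refine ⟨_, fun x => (Complex.log (q x)).im + Complex.arg (h x₀), hs,
    ⟨hx, by simp [q, h0]⟩, Set.inter_subset_left, ?_, ?_, ?_⟩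
  · intro x hx
    have h1 : ContDiffAt ℝ ∞ Complex.log (q x) :=
      (Complex.contDiffAt_log hx.2 (n := ∞)).restrict_scalars ℝ
    have h2 := h1.comp_contDiffWithinAt x (hq.mono Set.inter_subset_left x hx)
    exact (Complex.imCLM.contDiff.comp_contDiffWithinAt h2).add contDiffWithinAt_const
  · intro x hx hx0
    have := hx.2
    simp [q, hx0] at this
  · intro x hx
    have hqx : q x ≠ 0 := Complex.slitPlane_ne_zero hx.2
    have e1 : h x = q x * h x₀ := by simp [q, h0]
    conv_lhs => rw [e1, ← Complex.norm_mul_exp_arg_mul_I (q x),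
      ← Complex.norm_mul_exp_arg_mul_I (h x₀)]
    conv_rhs => rw [e1]
    simp only [Complex.log_im, norm_mul]
    push_cast
    rw [add_mul, Complex.exp_add]
    ring

/-- A smooth complex function which has at most a simple zero is locally `ρ exp (iη)`, where `ρ`
and `η` are smooth and real. -/
theorem exists_polar {h : ℝ → ℂ} {V : Set ℝ} {v₀ : ℝ} (hV : IsOpen V) (hv : v₀ ∈ V)
    (hh : ContDiffOn ℝ ∞ h V) (h0 : h v₀ = 0 → deriv h v₀ ≠ 0) :
    ∃ (V' : Set ℝ) (ρ η : ℝ → ℝ), IsOpen V' ∧ v₀ ∈ V' ∧ V' ⊆ V ∧ ContDiffOn ℝ ∞ ρ V' ∧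
      ContDiffOn ℝ ∞ η V' ∧ ∀ v ∈ V', h v = ρ v * Complex.exp (η v * Complex.I) := by
  by_cases hz : h v₀ = 0
  · obtain ⟨f, hf, hfh⟩ := exists_contDiff_eventuallyEq hV hv hh
    have hf0 : f v₀ = 0 := hfh.eq_of_nhds.trans hz
    obtain ⟨g, hg, hfg⟩ := exists_contDiff_eq_smul (f := fun v => f (v + v₀))
      (hf.comp (contDiff_id.add contDiff_const)) (by simpa using hf0)
    have hf2 : ∀ v, f v = (v - v₀) • g (v - v₀) := fun v => by simpa using hfg (v - v₀)
    have hgs : ContDiff ℝ ∞ fun v => g (v - v₀) := hg.comp (contDiff_id.sub contDiff_const)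
    have hd : deriv h v₀ = g 0 := by
      rw [← hfh.deriv_eq, funext hf2]
      have h1 := ((hasDerivAt_id v₀).sub_const v₀).smul
        (hgs.differentiable (by simp) v₀).hasDerivAt
      exact h1.deriv.trans (by simp)
    obtain ⟨V₁, η, hV₁, hv₁, -, hη, hne, hpol⟩ := exists_arg isOpen_univ (Set.mem_univ v₀)
      hgs.contDiffOn (by simpa [← hd] using h0 hz)
    obtain ⟨V₂, hV₂h, hV₂, hv₂⟩ := eventually_nhds_iff.1 hfh
    -- The radius is signed and changes sign at `v₀`. The norm of `h` would not be smooth there,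
    -- whereas `g` does not vanish near `0` and has a smooth norm and argument.
    refine ⟨V ∩ V₁ ∩ V₂, fun v => (v - v₀) * ‖g (v - v₀)‖, η, (hV.inter hV₁).inter hV₂,
      ⟨⟨hv, hv₁⟩, hv₂⟩, fun x hx => hx.1.1, ?_, hη.mono fun x hx => hx.1.2, ?_⟩
    · refine (contDiff_id.sub contDiff_const).contDiffOn.mul ?_
      exact hgs.contDiffOn.norm ℝ fun x hx => hne x hx.1.2
    · intro v hv'
      rw [← hV₂h v hv'.2, hf2 v, hpol v hv'.1.2]
      simp
      ring
  · obtain ⟨V', η, hV', hv', hsub, hη, hne, hpol⟩ := exists_arg hV hv hh hz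
    exact ⟨V', fun v => ‖h v‖, η, hV', hv', hsub, (hh.mono hsub).norm ℝ hne, hη, hpol⟩

/-! ### Angle functions for a curve of first rows -/

/-- A regular curve in the unit sphere, subject to the differential condition of admissible
functions, is locally a curve of first rows. -/
theorem exists_admissible {Y : ℝ → R4} {J : Set ℝ} {v₀ : ℝ} (hJ : IsOpen J) (hv₀ : v₀ ∈ J)
    (hY : ContDiffOn ℝ ∞ Y J) (hnorm : ∀ v ∈ J, inner ℝ (Y v) (Y v) = 1)
    (hode : ∀ v ∈ J, Y v 0 * deriv Y v 1 - Y v 1 * deriv Y v 0 =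
      Y v 2 * deriv Y v 3 - Y v 3 * deriv Y v 2) (hreg : deriv Y v₀ ≠ 0) (k : ℝ) :
    ∃ (c d : ℝ) (ξ₁ ξ₂ ξ₃ : ℝ → ℝ), v₀ ∈ Set.Ioo c d ∧ Set.Ioo c d ⊆ J ∧
      IsAdmissible (Set.Ioo c d) (fun _ => k) ξ₁ ξ₂ ξ₃ ∧
      ∀ v ∈ Set.Ioo c d, Y v = WithLp.toLp 2 (row1 (ξ₁ v) (ξ₂ v) (ξ₃ v)) := by
  have hcoord : ∀ i, ContDiffOn ℝ ∞ (fun v => Y v i) J := contDiffOn_euclidean.1 hY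
  have hder : ∀ v ∈ J, HasDerivAt Y (deriv Y v) v := fun v hv =>
    ((hY.contDiffAt (hJ.mem_nhds hv)).differentiableAt (by simp)).hasDerivAt
  have hd := hasDerivAt_R4.1 (hder v₀ hv₀)
  have hn' : Y v₀ 0 * deriv Y v₀ 0 + Y v₀ 1 * deriv Y v₀ 1 + Y v₀ 2 * deriv Y v₀ 2 +
      Y v₀ 3 * deriv Y v₀ 3 = 0 := by
    have h1 := ((((hd 0).pow 2).add ((hd 1).pow 2)).add ((hd 2).pow 2)).add ((hd 3).pow 2)
    have h2 := h1.unique ((hasDerivAt_const v₀ (1 : ℝ)).congr_of_eventuallyEq (by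
      filter_upwards [hJ.mem_nhds hv₀] with v hv
      have := hnorm v hv
      rw [inner_R4] at this
      simp only [Pi.add_apply, Pi.pow_apply]
      linarith))
    norm_num at h2
    linarith
  have hn := hnorm v₀ hv₀
  rw [inner_R4] at hn
  have ho := hode v₀ hv₀
  -- The minus sign matches `row1`, whose complex entries are the conjugates of `cos ξ₁ exp(iξ₂)`
  -- and `sin ξ₁ exp(iξ₃)`.
  have hcpx : ∀ i j : Fin 4, ContDiffOn ℝ ∞ (fun v => (⟨Y v i, -Y v j⟩ : ℂ)) J := fun i j => by
    have h := ((Complex.ofRealCLM.contDiff.comp_contDiffOn (hcoord i)).sub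
      ((Complex.ofRealCLM.contDiff.comp_contDiffOn (hcoord j)).mul
        (contDiffOn_const (c := Complex.I))))
    refine h.congr fun v _ => ?_
    apply Complex.ext <;> simp
  have hcd : ∀ i j : Fin 4, deriv (fun v => (⟨Y v i, -Y v j⟩ : ℂ)) v₀ = 0 →
      deriv Y v₀ i = 0 ∧ deriv Y v₀ j = 0 := fun i j h => by
    have h1 := (((hcpx i j).contDiffAt (hJ.mem_nhds hv₀)).differentiableAt (by simp)).hasDerivAt
    rw [h] at h1
    have h2 := (hd i).unique (Complex.reCLM.hasFDerivAt.comp_hasDerivAt v₀ h1)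
    have h3 := (hd j).neg.unique (Complex.imCLM.hasFDerivAt.comp_hasDerivAt v₀ h1)
    rw [map_zero] at h2 h3
    exact ⟨h2, neg_eq_zero.1 h3⟩
  have hzero : deriv Y v₀ 0 = 0 → deriv Y v₀ 1 = 0 → deriv Y v₀ 2 = 0 → deriv Y v₀ 3 = 0 →
      False := fun h0 h1 h2 h3 => hreg (by ext i; fin_cases i <;> simpa)
  -- If one complex entry vanished together with its derivative, the other would be a unit vector of
  -- `ℝ²` whose derivative is both orthogonal to it (unit norm) and parallel to it (the differential
  -- equation). Then `Y'` would vanish at `v₀`.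
  obtain ⟨V₁, ρ₁, ξ₂, hV₁, hv₁, hs₁, hρ₁, hξ₂, hp₁⟩ := exists_polar hJ hv₀ (hcpx 0 1)
    (fun h h' => by
      obtain ⟨h0, h1⟩ := hcd _ _ h'
      have y0 : Y v₀ 0 = 0 := congrArg Complex.re h
      have y1 : Y v₀ 1 = 0 := by simpa using congrArg Complex.im h
      rw [y0, y1] at hn' hn ho
      refine hzero h0 h1 ?_ ?_
      · linear_combination (-deriv Y v₀ 2) * hn + Y v₀ 2 * hn' + Y v₀ 3 * ho
      · linear_combination (-deriv Y v₀ 3) * hn + Y v₀ 3 * hn' - Y v₀ 2 * ho)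
  obtain ⟨V₂, ρ₂, ξ₃, hV₂, hv₂, hs₂, hρ₂, hξ₃, hp₂⟩ := exists_polar hJ hv₀ (hcpx 2 3)
    (fun h h' => by
      obtain ⟨h2, h3⟩ := hcd _ _ h'
      have y0 : Y v₀ 2 = 0 := congrArg Complex.re h
      have y1 : Y v₀ 3 = 0 := by simpa using congrArg Complex.im h
      rw [y0, y1] at hn' hn ho
      refine hzero ?_ ?_ h2 h3
      · linear_combination (-deriv Y v₀ 0) * hn + Y v₀ 0 * hn' - Y v₀ 1 * ho
      · linear_combination (-deriv Y v₀ 1) * hn + Y v₀ 1 * hn' + Y v₀ 0 * ho)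
  have hY₁ : ∀ v ∈ V₁, Y v 0 = ρ₁ v * Real.cos (ξ₂ v) ∧ Y v 1 = -(ρ₁ v * Real.sin (ξ₂ v)) := by
    intro v hv
    have h := hp₁ v hv
    rw [Complex.exp_mul_I, ← Complex.ofReal_cos, ← Complex.ofReal_sin] at h
    have h1 := congrArg Complex.re h
    have h2 := congrArg Complex.im h
    simp [-Complex.ofReal_cos, -Complex.ofReal_sin] at h1 h2
    exact ⟨h1, by linarith⟩
  have hY₂ : ∀ v ∈ V₂, Y v 2 = ρ₂ v * Real.cos (ξ₃ v) ∧ Y v 3 = -(ρ₂ v * Real.sin (ξ₃ v)) := by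
    intro v hv
    have h := hp₂ v hv
    rw [Complex.exp_mul_I, ← Complex.ofReal_cos, ← Complex.ofReal_sin] at h
    have h1 := congrArg Complex.re h
    have h2 := congrArg Complex.im h
    simp [-Complex.ofReal_cos, -Complex.ofReal_sin] at h1 h2
    exact ⟨h1, by linarith⟩
  have hρ : ∀ v ∈ V₁ ∩ V₂, ρ₁ v ^ 2 + ρ₂ v ^ 2 = 1 := by
    intro v hv
    have h := hnorm v (hs₁ hv.1)
    rw [inner_R4, (hY₁ v hv.1).1, (hY₁ v hv.1).2, (hY₂ v hv.2).1, (hY₂ v hv.2).2] at h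
    linear_combination h - ρ₁ v ^ 2 * Real.cos_sq_add_sin_sq (ξ₂ v) -
      ρ₂ v ^ 2 * Real.cos_sq_add_sin_sq (ξ₃ v)
  have hnρ : ∀ v ∈ V₁ ∩ V₂, ‖(⟨ρ₁ v, ρ₂ v⟩ : ℂ)‖ = 1 := fun v hv => by
    rw [Complex.norm_eq_sqrt_sq_add_sq, hρ v hv, Real.sqrt_one]
  have hρc : ContDiffOn ℝ ∞ (fun v => (⟨ρ₁ v, ρ₂ v⟩ : ℂ)) (V₁ ∩ V₂) := by
    have h := ((Complex.ofRealCLM.contDiff.comp_contDiffOn (hρ₁.mono Set.inter_subset_left)).add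
      ((Complex.ofRealCLM.contDiff.comp_contDiffOn (hρ₂.mono Set.inter_subset_right)).mul
        (contDiffOn_const (c := Complex.I))))
    refine h.congr fun v _ => ?_
    apply Complex.ext <;> simp
  -- The signed radii form a smooth curve on the unit circle, and its argument is `ξ₁`.
  obtain ⟨V₃, ξ₁, hV₃, hv₃, hs₃, hξ₁, -, hp₃⟩ := exists_arg (hV₁.inter hV₂) ⟨hv₁, hv₂⟩ hρc
    (by rw [← norm_pos_iff, hnρ v₀ ⟨hv₁, hv₂⟩]; exact one_pos)
  obtain ⟨c, d, hcd', hsub⟩ := mem_nhds_iff_exists_Ioo_subset.1 (hV₃.mem_nhds hv₃)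
  have hrow : ∀ v ∈ V₃, Y v = WithLp.toLp 2 (row1 (ξ₁ v) (ξ₂ v) (ξ₃ v)) := by
    intro v hv
    have h := hp₃ v hv
    rw [hnρ v (hs₃ hv), Complex.exp_mul_I, ← Complex.ofReal_cos, ← Complex.ofReal_sin] at h
    have h1 := congrArg Complex.re h
    have h2 := congrArg Complex.im h
    simp [-Complex.ofReal_cos, -Complex.ofReal_sin] at h1 h2
    have h3 := hY₁ v (hs₃ hv).1
    have h4 := hY₂ v (hs₃ hv).2
    rw [h1] at h3
    rw [h2] at h4
    ext i
    fin_cases i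
    exacts [h3.1, h3.2, h4.1, h4.2]
  have c1 := hξ₁.mono hsub
  have c2 := hξ₂.mono fun v hv => (hs₃ (hsub hv)).1
  have c3 := hξ₃.mono fun v hv => (hs₃ (hsub hv)).2
  refine ⟨c, d, ξ₁, ξ₂, ξ₃, hcd', fun v hv => hs₁ (hs₃ (hsub hv)).1,
    ⟨contDiffOn_const, c1, c2, c3, ⟨k, fun _ _ => rfl⟩, fun v hv => ?_⟩,
    fun v hv => hrow v (hsub hv)⟩
  have hd' : ∀ {g : ℝ → ℝ}, ContDiffOn ℝ ∞ g (Set.Ioo c d) → HasDerivAt g (deriv g v) v :=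
    fun hg => ((hg.contDiffAt (isOpen_Ioo.mem_nhds hv)).differentiableAt (by simp)).hasDerivAt
  have h1 := hasDerivAt_row1 (hd' c1) (hd' c2) (hd' c3)
  have h2 := h1.congr_of_eventuallyEq (f₁ := Y) (by
    filter_upwards [hV₃.mem_nhds (hsub hv)] with v hv using hrow v hv)
  have h3 := hode v (hs₁ (hs₃ (hsub hv)).1)
  rw [h2.deriv, hrow v (hsub hv)] at h3
  have h4 := row1_wedge_row1Vel (ξ₁ v) (ξ₂ v) (ξ₃ v) (deriv ξ₁ v) (deriv ξ₂ v) (deriv ξ₃ v)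
  simp only [PiLp.toLp_apply] at h3
  linarith

/-! ### The quaternionic frame and the angle condition -/

/-- The left multiplication by the unit `J₂` of the quaternions. -/
def frame2 (x : R4) : R4 := !₂[-x 3, -x 2, x 1, x 0]

/-- The left multiplication by the unit `J₃` of the quaternions. -/
def frame3 (x : R4) : R4 := !₂[-x 2, x 3, x 0, -x 1]

theorem inner_frame2_self (x : R4) : inner ℝ x (frame2 x) = 0 := by
  rw [inner_R4, frame2]; simp; ring

theorem inner_frame3_self (x : R4) : inner ℝ x (frame3 x) = 0 := by
  rw [inner_R4, frame3]; simp; ring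

theorem frame_expansion {p X : R4} (hp : inner ℝ p p = 1) (hX : inner ℝ p X = 0) :
    X = inner ℝ X (hopfField p) • hopfField p + inner ℝ X (frame2 p) • frame2 p +
      inner ℝ X (frame3 p) • frame3 p := by
  simp only [inner_R4] at *
  ext i
  fin_cases i <;> simp [hopfField_eq, frame2, frame3]
  · linear_combination (-X 0) * hp + p 0 * hX
  · linear_combination (-X 1) * hp + p 1 * hX
  · linear_combination (-X 2) * hp + p 2 * hX
  · linear_combination (-X 3) * hp + p 3 * hX

theorem inner_frame {p : R4} (hp : inner ℝ p p = 1) (a b c a' b' c' : ℝ) :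
    inner ℝ (a • hopfField p + b • frame2 p + c • frame3 p)
      (a' • hopfField p + b' • frame2 p + c' • frame3 p) = a * a' + b * b' + c * c' := by
  simp only [inner_R4] at *
  simp [hopfField_eq, frame2, frame3]
  linear_combination (a * a' + b * b' + c * c') * hp

theorem bergerMetric_frame {ε : ℝ} {p : R4} (hp : inner ℝ p p = 1) (a b c a' b' c' : ℝ) :
    bergerMetric ε p (a • hopfField p + b • frame2 p + c • frame3 p)
      (a' • hopfField p + b' • frame2 p + c' • frame3 p) =
      ε ^ 2 * (a * a') + b * b' + c * c' := by
  have h := inner_frame hp a b c a' b' c'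
  have h1 := inner_frame hp a b c 1 0 0
  have h2 := inner_frame hp a' b' c' 1 0 0
  simp only [one_smul, zero_smul, add_zero, mul_one, mul_zero] at h1 h2
  rw [bergerMetric, h, h1, h2]
  ring

/-- The cross product `(m₁, m₂, m₃)` of the frame coordinates of `X` and `Y` is a Euclidean
conormal. The Berger normal is proportional to `(m₁/ε², m₂, m₃)`, and its angle with the Hopf field
gives the equation. If `m₁ = 0`, positivity of `c` makes the whole cross product vanish, against
independence. -/
theorem angle_condition {ε c : ℝ} (hε : 0 < ε) (hc : 0 < c) {p X Y : R4}
    (hp : inner ℝ p p = 1) (hind : ∀ a b : ℝ, a • X + b • Y = 0 → a = 0 ∧ b = 0)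
    (hang : ∀ n, inner ℝ p n = 0 → bergerMetric ε p n X = 0 → bergerMetric ε p n Y = 0 →
      bergerMetric ε p n n = 1 → |bergerMetric ε p (hopfField p) n| = ε * c)
    {a₁ a₂ a₃ b₁ b₂ b₃ : ℝ}
    (hXe : X = a₁ • hopfField p + a₂ • frame2 p + a₃ • frame3 p)
    (hYe : Y = b₁ • hopfField p + b₂ • frame2 p + b₃ • frame3 p) :
    a₂ * b₃ - a₃ * b₂ ≠ 0 ∧ (a₂ * b₃ - a₃ * b₂) ^ 2 * (1 - c ^ 2) =
      (ε * c) ^ 2 * ((a₃ * b₁ - a₁ * b₃) ^ 2 + (a₁ * b₂ - a₂ * b₁) ^ 2) := by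
  obtain ⟨m₁, hm₁⟩ : ∃ m, m = a₂ * b₃ - a₃ * b₂ := ⟨_, rfl⟩
  obtain ⟨m₂, hm₂⟩ : ∃ m, m = a₃ * b₁ - a₁ * b₃ := ⟨_, rfl⟩
  obtain ⟨m₃, hm₃⟩ : ∃ m, m = a₁ * b₂ - a₂ * b₁ := ⟨_, rfl⟩
  have hm : ¬ (m₁ = 0 ∧ m₂ = 0 ∧ m₃ = 0) := by
    rintro ⟨h1, h2, h3⟩
    rw [h1] at hm₁
    rw [h2] at hm₂
    rw [h3] at hm₃
    -- If the cross product is zero, `|a|² b = (a · b) a`, which is a linear relation between `X`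
    -- and `Y`.
    have e : (-(a₁ * b₁ + a₂ * b₂ + a₃ * b₃)) • X + (a₁ ^ 2 + a₂ ^ 2 + a₃ ^ 2) • Y = 0 := by
      have e1 : (a₁ ^ 2 + a₂ ^ 2 + a₃ ^ 2) * b₁ = (a₁ * b₁ + a₂ * b₂ + a₃ * b₃) * a₁ := by
        linear_combination (-a₃) * hm₂ + a₂ * hm₃
      have e2 : (a₁ ^ 2 + a₂ ^ 2 + a₃ ^ 2) * b₂ = (a₁ * b₁ + a₂ * b₂ + a₃ * b₃) * a₂ := by
        linear_combination a₃ * hm₁ - a₁ * hm₃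
      have e3 : (a₁ ^ 2 + a₂ ^ 2 + a₃ ^ 2) * b₃ = (a₁ * b₁ + a₂ * b₂ + a₃ * b₃) * a₃ := by
        linear_combination (-a₂) * hm₁ + a₁ * hm₂
      rw [hXe, hYe, smul_add, smul_add, smul_add, smul_add, smul_smul, smul_smul, smul_smul,
        smul_smul, smul_smul, smul_smul, e1, e2, e3]
      module
    have ha := (hind _ _ e).2
    have h1 : a₁ = 0 := by nlinarith [sq_nonneg a₁, sq_nonneg a₂, sq_nonneg a₃]
    have h2 : a₂ = 0 := by nlinarith [sq_nonneg a₁, sq_nonneg a₂, sq_nonneg a₃]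
    have h3 : a₃ = 0 := by nlinarith [sq_nonneg a₁, sq_nonneg a₂, sq_nonneg a₃]
    have := (hind 1 0 (by rw [hXe, h1, h2, h3]; simp)).1
    norm_num at this
  have hD : 0 < m₁ ^ 2 / ε ^ 2 + m₂ ^ 2 + m₃ ^ 2 := by
    by_contra hcon
    have h1 : 0 ≤ m₁ ^ 2 / ε ^ 2 := by positivity
    have h2 : m₁ ^ 2 / ε ^ 2 = 0 := by nlinarith [sq_nonneg m₂, sq_nonneg m₃]
    refine hm ⟨?_, ?_, ?_⟩
    · rcases div_eq_zero_iff.1 h2 with h | h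
      · exact pow_eq_zero_iff two_ne_zero |>.1 h
      · exact absurd h (by positivity)
    · nlinarith [sq_nonneg m₂, sq_nonneg m₃]
    · nlinarith [sq_nonneg m₂, sq_nonneg m₃]
  obtain ⟨D, hDe⟩ : ∃ D, D = m₁ ^ 2 / ε ^ 2 + m₂ ^ 2 + m₃ ^ 2 := ⟨_, rfl⟩
  rw [← hDe] at hD
  have hs := Real.sq_sqrt hD.le
  have hs0 : √D ≠ 0 := (Real.sqrt_pos.2 hD).ne'
  have key := hang ((m₁ / ε ^ 2 / √D) • hopfField p + (m₂ / √D) • frame2 p + (m₃ / √D) • frame3 p)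
    ?_ ?_ ?_ ?_
  · have h1 := bergerMetric_frame (ε := ε) hp 1 0 0 (m₁ / ε ^ 2 / √D) (m₂ / √D) (m₃ / √D)
    simp only [one_smul, zero_smul, add_zero, one_mul, zero_mul] at h1
    rw [h1] at key
    have h2 : (m₁ / √D) ^ 2 = (ε * c) ^ 2 := by
      rw [← sq_abs, ← key]; congr 2; field_simp
    have h3 : m₁ ^ 2 = (ε * c) ^ 2 * (m₁ ^ 2 / ε ^ 2 + m₂ ^ 2 + m₃ ^ 2) := by
      rw [div_pow, hs, div_eq_iff hD.ne', hDe] at h2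
      exact h2
    have h4 : m₁ ^ 2 * (1 - c ^ 2) = (ε * c) ^ 2 * (m₂ ^ 2 + m₃ ^ 2) := by
      have : (ε * c) ^ 2 * (m₁ ^ 2 / ε ^ 2 + m₂ ^ 2 + m₃ ^ 2) =
          c ^ 2 * m₁ ^ 2 + (ε * c) ^ 2 * (m₂ ^ 2 + m₃ ^ 2) := by field_simp; ring
      linarith
    rw [← hm₁, ← hm₂, ← hm₃]
    refine ⟨fun h => hm ⟨h, ?_⟩, h4⟩
    have h5 : 0 < (ε * c) ^ 2 := by positivity
    have h6 : m₂ ^ 2 + m₃ ^ 2 = 0 := by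
      rw [h] at h4
      rcases mul_eq_zero.1 (show (ε * c) ^ 2 * (m₂ ^ 2 + m₃ ^ 2) = 0 by linarith) with h | h
      · exact absurd h h5.ne'
      · exact h
    exact ⟨by nlinarith only [h6, sq_nonneg m₂, sq_nonneg m₃],
      by nlinarith only [h6, sq_nonneg m₂, sq_nonneg m₃]⟩
  · simp only [inner_add_right, real_inner_smul_right, inner_hopfField_self, inner_frame2_self,
      inner_frame3_self, mul_zero, add_zero]
  · rw [hXe, bergerMetric_frame hp, hm₁, hm₂, hm₃]
    field_simp
    ring
  · rw [hYe, bergerMetric_frame hp, hm₁, hm₂, hm₃]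
    field_simp
    ring
  · rw [bergerMetric_frame hp]
    have : ε ^ 2 * (m₁ / ε ^ 2 / √D * (m₁ / ε ^ 2 / √D)) + m₂ / √D * (m₂ / √D) +
        m₃ / √D * (m₃ / √D) = (m₁ ^ 2 / ε ^ 2 + m₂ ^ 2 + m₃ ^ 2) / √D ^ 2 := by
      field_simp
    rw [this, hs, ← hDe, div_self hD.ne']

/-! ### The structure equations of a helix surface, in a chart -/

noncomputable def hopfFieldL : R4 →L[ℝ] R4 := LinearMap.toContinuousLinearMap
  { toFun := hopfField
    map_add' := fun _ _ => by simp only [hopfField_eq]; ext i; fin_cases i <;> simp <;> ring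
    map_smul' := fun _ _ => by simp only [hopfField_eq]; ext i; fin_cases i <;> simp }

noncomputable def frame2L : R4 →L[ℝ] R4 := LinearMap.toContinuousLinearMap
  { toFun := frame2
    map_add' := fun _ _ => by ext i; fin_cases i <;> simp [frame2] <;> ring
    map_smul' := fun _ _ => by ext i; fin_cases i <;> simp [frame2] }

noncomputable def frame3L : R4 →L[ℝ] R4 := LinearMap.toContinuousLinearMap
  { toFun := frame3
    map_add' := fun _ _ => by ext i; fin_cases i <;> simp [frame3] <;> ring
    map_smul' := fun _ _ => by ext i; fin_cases i <;> simp [frame3] }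

theorem hopfFieldL_apply (x : R4) : hopfFieldL x = hopfField x := rfl

theorem frame2L_apply (x : R4) : frame2L x = frame2 x := rfl

theorem frame3L_apply (x : R4) : frame3L x = frame3 x := rfl

/-- The vector with coordinates `a, b, c` in the quaternionic frame at `p`. -/
noncomputable def frameComb (a b c : ℝ) (p : R4) : R4 :=
  a • hopfField p + b • frame2 p + c • frame3 p

/-- Multiplication of imaginary quaternions: the value is the scalar triple product of the
coordinate vectors, hence skew in the two tangent vectors. -/
theorem inner_frameComb_frameComb {p : R4} (hp : inner ℝ p p = 1) (a b c x₁ x₂ x₃ y₁ y₂ y₃ : ℝ) :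
    inner ℝ (frameComb y₁ y₂ y₃ p) (frameComb a b c (frameComb x₁ x₂ x₃ p)) =
      a * (y₂ * x₃ - y₃ * x₂) + b * (y₃ * x₁ - y₁ * x₃) + c * (y₁ * x₂ - y₂ * x₁) := by
  simp only [inner_R4] at *
  simp [frameComb, hopfField_eq, frame2, frame3]
  linear_combination
    (a * (y₂ * x₃ - y₃ * x₂) + b * (y₃ * x₁ - y₁ * x₃) + c * (y₁ * x₂ - y₂ * x₁)) * hp

/-- Differentiating `⟨∂_w f, ν⟩ = 0` along `v` gives `⟨∂_w f, ∂_v ν⟩ = -⟨∂_v ∂_w f, ν⟩`, which is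
symmetric in `v, w`. This is the only integrability condition the argument needs. -/
theorem inner_fderiv_symm {W : Set R2} (hW : IsOpen W) {f ν : R2 → R4} (hf : ContDiffOn ℝ ∞ f W)
    (hΩ : ∀ q ∈ W, ∀ w, inner ℝ (fderiv ℝ f q w) (ν q) = 0) {q : R2} (hq : q ∈ W)
    (hν : DifferentiableAt ℝ ν q) (v w : R2) :
    inner ℝ (fderiv ℝ f q w) (fderiv ℝ ν q v) = inner ℝ (fderiv ℝ f q v) (fderiv ℝ ν q w) := by
  have hfq : ContDiffAt ℝ ∞ f q := hf.contDiffAt (hW.mem_nhds hq)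
  have hsymm : IsSymmSndFDerivAt ℝ f q := hfq.isSymmSndFDerivAt
    (by simp only [minSmoothness_of_isRCLikeNormedField]; exact WithTop.coe_le_coe.2 le_top)
  have hD : DifferentiableAt ℝ (fderiv ℝ f) q :=
    (hfq.fderiv_right (m := ∞) (by simp)).differentiableAt (by simp)
  have key : ∀ v w, inner ℝ (fderiv ℝ f q w) (fderiv ℝ ν q v) +
      inner ℝ (fderiv ℝ (fderiv ℝ f) q v w) (ν q) = 0 := by
    intro v w
    have h1 : HasFDerivAt (fun q => fderiv ℝ f q w) ((fderiv ℝ (fderiv ℝ f) q).flip w) q := by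
      have := hD.hasFDerivAt.clm_apply (hasFDerivAt_const w q)
      simpa using this
    have h2 := h1.inner ℝ hν.hasFDerivAt
    have h3 := h2.unique ((hasFDerivAt_const (0 : ℝ) q).congr_of_eventuallyEq (by
      filter_upwards [hW.mem_nhds hq] with x hx using hΩ x hx w))
    simpa using congrArg (fun L : R2 →L[ℝ] ℝ => L v) h3
  have h1 := key v w
  have h2 := key w v
  rw [hsymm.eq v w] at h1
  linarith

theorem fderiv_R2 {F : Type*} [NormedAddCommGroup F] [NormedSpace ℝ F] (L : R2 →L[ℝ] F) (w : R2) :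
    L w = w 0 • L (EuclideanSpace.single 0 1) + w 1 • L (EuclideanSpace.single 1 1) := by
  rw [← map_smul, ← map_smul, ← map_add]
  congr 1
  ext i
  fin_cases i <;> simp

theorem eq_zero_of_injective {L : R2 →L[ℝ] R4} (hL : Function.Injective L) (a b : ℝ)
    (h : a • L (EuclideanSpace.single 0 1) + b • L (EuclideanSpace.single 1 1) = 0) :
    a = 0 ∧ b = 0 := by
  have h1 := fderiv_R2 L !₂[a, b]
  simp only [PiLp.toLp_apply, Matrix.cons_val_zero, Matrix.cons_val_one] at h1
  rw [h] at h1
  have h0 : (!₂[a, b] : R2) = 0 := hL (by rw [h1, map_zero])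
  exact ⟨by simpa using congrArg (fun y : R2 => y 0) h0,
    by simpa using congrArg (fun y : R2 => y 1) h0⟩

/-- A parametrised helix surface. -/
structure IsHelixPatch (ε θ : ℝ) (W : Set R2) (f : R2 → R4) : Prop where
  isOpen : IsOpen W
  smooth : ContDiffOn ℝ ∞ f W
  norm : ∀ q ∈ W, inner ℝ (f q) (f q) = 1
  immersion : ∀ q ∈ W, Function.Injective (fderiv ℝ f q)
  angle : ∀ q ∈ W, ∀ n, inner ℝ (f q) n = 0 →
    (∀ w, bergerMetric ε (f q) n (fderiv ℝ f q w) = 0) → bergerMetric ε (f q) n n = 1 →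
    |bergerMetric ε (f q) (hopfField (f q)) n| = ε * Real.cos θ

/-- The functions `l, m` are the components of the unit normal along the last two fields of the
frame: the normal direction is given by the covector `(ε cos θ, l, m)`. -/
structure IsNormalPair (ε θ : ℝ) (W : Set R2) (f : R2 → R4) (l m : R2 → ℝ) : Prop where
  smooth_left : ContDiffOn ℝ ∞ l W
  smooth_right : ContDiffOn ℝ ∞ m W
  sq_add_sq : ∀ q ∈ W, l q ^ 2 + m q ^ 2 = Real.sin θ ^ 2
  normal : ∀ q ∈ W, ∀ w,
    inner ℝ (fderiv ℝ f q w) (frameComb (ε * Real.cos θ) (l q) (m q) (f q)) = 0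
  transverse : ∀ q ∈ W, ∀ y z : ℝ, ∃ w, inner ℝ (fderiv ℝ f q w) (frame2 (f q)) = y ∧
    inner ℝ (fderiv ℝ f q w) (frame3 (f q)) = z

variable {ε θ : ℝ} {W : Set R2} {f : R2 → R4}

theorem IsHelixPatch.tangent (hf : IsHelixPatch ε θ W f) {q : R2} (hq : q ∈ W) (w : R2) :
    inner ℝ (f q) (fderiv ℝ f q w) = 0 := by
  have h1 := ((hf.smooth.contDiffAt (hf.isOpen.mem_nhds hq)).differentiableAt
    (by simp)).hasFDerivAt
  have h2 := (h1.inner ℝ h1).unique ((hasFDerivAt_const (1 : ℝ) q).congr_of_eventuallyEq (by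
      filter_upwards [hf.isOpen.mem_nhds hq] with x hx using hf.norm x hx))
  have h3 := congrArg (fun L : R2 →L[ℝ] ℝ => L w) h2
  simp at h3
  linarith [real_inner_comm (f q) (fderiv ℝ f q w)]

/-- By `angle_condition` the cross product of the coordinate tangent vectors has nonzero first
component, so it can be rescaled to have first component `ε cos θ`. The same nonvanishing says that
the tangent plane projects isomorphically to the last two frame directions. -/
theorem IsHelixPatch.exists_normalPair (hε : 0 < ε) (hθ : θ ∈ Set.Ico 0 (Real.pi / 2))
    (hf : IsHelixPatch ε θ W f) : ∃ l m, IsNormalPair ε θ W f l m := by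
  let X : R2 → R4 := fun q => fderiv ℝ f q (EuclideanSpace.single 0 1)
  let Y : R2 → R4 := fun q => fderiv ℝ f q (EuclideanSpace.single 1 1)
  have hX : ContDiffOn ℝ ∞ X W := (hf.smooth.fderiv_of_isOpen hf.isOpen (by simp)).clm_apply
    contDiffOn_const
  have hY : ContDiffOn ℝ ∞ Y W := (hf.smooth.fderiv_of_isOpen hf.isOpen (by simp)).clm_apply
    contDiffOn_const
  have j1 := hopfFieldL.contDiff.comp_contDiffOn hf.smooth
  have j2 := frame2L.contDiff.comp_contDiffOn hf.smooth
  have j3 := frame3L.contDiff.comp_contDiffOn hf.smooth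
  let a₁ : R2 → ℝ := fun q => inner ℝ (X q) (hopfField (f q))
  let a₂ : R2 → ℝ := fun q => inner ℝ (X q) (frame2 (f q))
  let a₃ : R2 → ℝ := fun q => inner ℝ (X q) (frame3 (f q))
  let b₁ : R2 → ℝ := fun q => inner ℝ (Y q) (hopfField (f q))
  let b₂ : R2 → ℝ := fun q => inner ℝ (Y q) (frame2 (f q))
  let b₃ : R2 → ℝ := fun q => inner ℝ (Y q) (frame3 (f q))
  have ha₁ : ContDiffOn ℝ ∞ a₁ W := hX.inner ℝ j1
  have ha₂ : ContDiffOn ℝ ∞ a₂ W := hX.inner ℝ j2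
  have ha₃ : ContDiffOn ℝ ∞ a₃ W := hX.inner ℝ j3
  have hb₁ : ContDiffOn ℝ ∞ b₁ W := hY.inner ℝ j1
  have hb₂ : ContDiffOn ℝ ∞ b₂ W := hY.inner ℝ j2
  have hb₃ : ContDiffOn ℝ ∞ b₃ W := hY.inner ℝ j3
  have key : ∀ q ∈ W, a₂ q * b₃ q - a₃ q * b₂ q ≠ 0 ∧
      (a₂ q * b₃ q - a₃ q * b₂ q) ^ 2 * (1 - Real.cos θ ^ 2) =
      (ε * Real.cos θ) ^ 2 * ((a₃ q * b₁ q - a₁ q * b₃ q) ^ 2 +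
        (a₁ q * b₂ q - a₂ q * b₁ q) ^ 2) := by
    intro q hq
    refine angle_condition hε (cos_pos_of_mem hθ) (hf.norm q hq)
      (eq_zero_of_injective (hf.immersion q hq)) (fun n h1 h2 h3 h4 => hf.angle q hq n h1 ?_ h4)
      (frame_expansion (hf.norm q hq) (hf.tangent hq _))
      (frame_expansion (hf.norm q hq) (hf.tangent hq _))
    intro w
    rw [fderiv_R2 (fderiv ℝ f q) w]
    simp only [bergerMetric, inner_add_right, inner_add_left, real_inner_smul_left,
      real_inner_smul_right] at h2 h3 ⊢
    linear_combination w 0 * h2 + w 1 * h3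
  refine ⟨fun q => ε * Real.cos θ * (a₃ q * b₁ q - a₁ q * b₃ q) / (a₂ q * b₃ q - a₃ q * b₂ q),
    fun q => ε * Real.cos θ * (a₁ q * b₂ q - a₂ q * b₁ q) / (a₂ q * b₃ q - a₃ q * b₂ q),
    ?_, ?_, ?_, ?_, ?_⟩
  · exact (contDiffOn_const.mul ((ha₃.mul hb₁).sub (ha₁.mul hb₃))).div
      ((ha₂.mul hb₃).sub (ha₃.mul hb₂)) fun q hq => (key q hq).1
  · exact (contDiffOn_const.mul ((ha₁.mul hb₂).sub (ha₂.mul hb₁))).div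
      ((ha₂.mul hb₃).sub (ha₃.mul hb₂)) fun q hq => (key q hq).1
  · intro q hq
    obtain ⟨h0, h1⟩ := key q hq
    obtain ⟨M, hM⟩ : ∃ M, M = a₂ q * b₃ q - a₃ q * b₂ q := ⟨_, rfl⟩
    rw [← hM] at h0 h1
    simp only [← hM]
    rw [Real.sin_sq, div_pow, div_pow, ← add_div, div_eq_iff (pow_ne_zero 2 h0)]
    linear_combination -h1
  · intro q hq w
    obtain ⟨h0, -⟩ := key q hq
    have e : ∀ a b c : ℝ, ∀ Z : R4, inner ℝ Z (frameComb a b c (f q)) =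
        a * inner ℝ Z (hopfField (f q)) + b * inner ℝ Z (frame2 (f q)) +
          c * inner ℝ Z (frame3 (f q)) := fun a b c Z => by
      simp only [frameComb, inner_add_right, real_inner_smul_right]
    rw [fderiv_R2 (fderiv ℝ f q) w, inner_add_left, real_inner_smul_left, real_inner_smul_left,
      e, e]
    change w 0 * (_ * a₁ q + _ * a₂ q + _ * a₃ q) + w 1 * (_ * b₁ q + _ * b₂ q + _ * b₃ q) = 0
    obtain ⟨M, hM⟩ : ∃ M, M = a₂ q * b₃ q - a₃ q * b₂ q := ⟨_, rfl⟩
    simp only [← hM] at h0 ⊢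
    field_simp
    rw [hM]
    ring
  · intro q hq y z
    obtain ⟨h0, -⟩ := key q hq
    obtain ⟨M, hM⟩ : ∃ M, M = a₂ q * b₃ q - a₃ q * b₂ q := ⟨_, rfl⟩
    rw [← hM] at h0
    -- Cramer's rule.
    refine ⟨!₂[(y * b₃ q - z * b₂ q) / M, (a₂ q * z - a₃ q * y) / M], ?_, ?_⟩
    · rw [fderiv_R2 (fderiv ℝ f q), inner_add_left, real_inner_smul_left, real_inner_smul_left]
      change (y * b₃ q - z * b₂ q) / M * a₂ q +
        (a₂ q * z - a₃ q * y) / M * b₂ q = y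
      field_simp
      rw [hM]
      ring
    · rw [fderiv_R2 (fderiv ℝ f q), inner_add_left, real_inner_smul_left, real_inner_smul_left]
      change (y * b₃ q - z * b₂ q) / M * a₃ q +
        (a₂ q * z - a₃ q * y) / M * b₃ q = z
      field_simp
      rw [hM]
      ring

theorem fderiv_frameComb {C : ℝ} {l m : R2 → ℝ} {q : R2} (hf : DifferentiableAt ℝ f q)
    (hl : DifferentiableAt ℝ l q) (hm : DifferentiableAt ℝ m q) :
    DifferentiableAt ℝ (fun q => frameComb C (l q) (m q) (f q)) q ∧
    ∀ v, fderiv ℝ (fun q => frameComb C (l q) (m q) (f q)) q v =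
      frameComb C (l q) (m q) (fderiv ℝ f q v) +
        frameComb 0 (fderiv ℝ l q v) (fderiv ℝ m q v) (f q) := by
  have h1 := (hopfFieldL.hasFDerivAt.comp q hf.hasFDerivAt).const_smul C
  have h2 := hl.hasFDerivAt.smul (frame2L.hasFDerivAt.comp q hf.hasFDerivAt)
  have h3 := hm.hasFDerivAt.smul (frame3L.hasFDerivAt.comp q hf.hasFDerivAt)
  have h : HasFDerivAt (fun q => frameComb C (l q) (m q) (f q)) _ q := (h1.add h2).add h3
  refine ⟨h.differentiableAt, fun v => ?_⟩
  rw [h.fderiv]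
  simp [frameComb, hopfFieldL_apply, frame2L_apply, frame3L_apply]
  module

theorem inner_frameComb (a b c : ℝ) (p Z : R4) : inner ℝ Z (frameComb a b c p) =
    a * inner ℝ Z (hopfField p) + b * inner ℝ Z (frame2 p) + c * inner ℝ Z (frame3 p) := by
  simp only [frameComb, inner_add_right, real_inner_smul_right]

/-- The horizontal distribution is not integrable: the angle cannot vanish. -/
theorem IsNormalPair.sin_ne_zero (hε : 0 < ε) (hθ : θ ∈ Set.Ico 0 (Real.pi / 2))
    (hf : IsHelixPatch ε θ W f) {l m : R2 → ℝ} (h : IsNormalPair ε θ W f l m) {q : R2}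
    (hq : q ∈ W) : Real.sin θ ≠ 0 := by
  intro hs
  have hC : ε * Real.cos θ ≠ 0 := (mul_pos hε (cos_pos_of_mem hθ)).ne'
  have hl : ∀ q ∈ W, l q = 0 ∧ m q = 0 := fun q hq => by
    have := h.sq_add_sq q hq
    rw [hs] at this
    constructor <;> nlinarith [sq_nonneg (l q), sq_nonneg (m q)]
  have hdf := (hf.smooth.contDiffAt (hf.isOpen.mem_nhds hq)).differentiableAt (by simp)
  have hΩ : ∀ q ∈ W, ∀ w, inner ℝ (fderiv ℝ f q w) (frameComb (ε * Real.cos θ) 0 0 (f q)) = 0 := by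
    intro q hq w
    have := h.normal q hq w
    rwa [(hl q hq).1, (hl q hq).2] at this
  obtain ⟨hd, hd'⟩ := fderiv_frameComb (C := ε * Real.cos θ) (l := fun _ => 0) (m := fun _ => 0)
    hdf (differentiableAt_const 0) (differentiableAt_const 0)
  -- If `sin θ = 0`, the conormal is a constant multiple of the Hopf field and the tangent plane is
  -- spanned by `J₂f` and `J₃f`. The form `⟨df w, J₁ df v⟩` is skew but would have to be symmetric,
  -- while its value on this pair is nonzero.
  obtain ⟨v, hv2, hv3⟩ := h.transverse q hq 0 1
  obtain ⟨w, hw2, hw3⟩ := h.transverse q hq 1 0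
  have key := inner_fderiv_symm hf.isOpen hf.smooth hΩ hq hd v w
  have hv1 := hΩ q hq v
  have hw1 := hΩ q hq w
  rw [inner_frameComb] at hv1 hw1
  simp only [zero_mul, add_zero, mul_eq_zero, hC, false_or] at hv1 hw1
  have ev := frame_expansion (hf.norm q hq) (hf.tangent hq v)
  have ew := frame_expansion (hf.norm q hq) (hf.tangent hq w)
  rw [hv1, hv2, hv3] at ev
  rw [hw1, hw2, hw3] at ew
  have e0 : frameComb 0 0 0 (f q) = 0 := by simp [frameComb]
  simp only [hd', fderiv_fun_const, Pi.zero_apply, zero_apply, e0,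
    add_zero] at key
  rw [ev, ew] at key
  have k1 := inner_frameComb_frameComb (hf.norm q hq) (ε * Real.cos θ) 0 0 0 0 1 0 1 0
  have k2 := inner_frameComb_frameComb (hf.norm q hq) (ε * Real.cos θ) 0 0 0 1 0 0 0 1
  have key' := k1.symm.trans (key.trans k2)
  norm_num at key'
  exact hC (by linarith)

/-- The tangential part of `E₁`. -/
theorem IsNormalPair.exists_tangent (hθ : θ ∈ Set.Ico 0 (Real.pi / 2))
    (hf : IsHelixPatch ε θ W f) {l m : R2 → ℝ} (h : IsNormalPair ε θ W f l m) {q : R2}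
    (hq : q ∈ W) : ∃ τ, ε • fderiv ℝ f q τ = frameComb (Real.sin θ ^ 2)
      (-(ε * Real.cos θ * l q)) (-(ε * Real.cos θ * m q)) (f q) := by
  have hC : Real.cos θ ≠ 0 := (cos_pos_of_mem hθ).ne'
  -- The unit normal has frame components `(ε⁻¹ cos θ, l, m)`. These are the last two components of
  -- `E₁ - cos θ N`, and the normal equation forces the first.
  obtain ⟨τ, h2, h3⟩ := h.transverse q hq (-(Real.cos θ * l q)) (-(Real.cos θ * m q))
  have h1 := h.normal q hq τ
  rw [inner_frameComb, h2, h3] at h1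
  have h1' : ε * inner ℝ (fderiv ℝ f q τ) (hopfField (f q)) = Real.sin θ ^ 2 := by
    apply mul_left_cancel₀ hC
    linear_combination h1 + Real.cos θ * h.sq_add_sq q hq
  refine ⟨τ, ?_⟩
  rw [frame_expansion (hf.norm q hq) (hf.tangent hq τ), h2, h3, frameComb, ← h1']
  module

/-- The angular velocity of the normal along the tangential part of `E₁`. -/
theorem IsNormalPair.fderiv_angle (hε : 0 < ε) (hθ : θ ∈ Set.Ico 0 (Real.pi / 2))
    (hf : IsHelixPatch ε θ W f) {l m φ : R2 → ℝ} (h : IsNormalPair ε θ W f l m)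
    (hφ : ContDiffOn ℝ ∞ φ W) (hl : ∀ q ∈ W, l q = Real.sin θ * Real.cos (φ q))
    (hm : ∀ q ∈ W, m q = Real.sin θ * Real.sin (φ q)) {q τ : R2}
    (hq : q ∈ W) (hτ : ε • fderiv ℝ f q τ = frameComb (Real.sin θ ^ 2)
      (-(ε * Real.cos θ * l q)) (-(ε * Real.cos θ * m q)) (f q)) :
    ε * fderiv ℝ φ q τ = -2 * constB ε θ := by
  have hs := h.sin_ne_zero hε hθ hf hq
  have hdf := (hf.smooth.contDiffAt (hf.isOpen.mem_nhds hq)).differentiableAt (by simp)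
  have hdl := (h.smooth_left.contDiffAt (hf.isOpen.mem_nhds hq)).differentiableAt (by simp)
  have hdm := (h.smooth_right.contDiffAt (hf.isOpen.mem_nhds hq)).differentiableAt (by simp)
  have hdφ := ((hφ.contDiffAt (hf.isOpen.mem_nhds hq)).differentiableAt (by simp)).hasFDerivAt
  have hl' : ∀ v, fderiv ℝ l q v = -m q * fderiv ℝ φ q v := fun v => by
    have h1 := (hdφ.cos.const_mul (Real.sin θ)).congr_of_eventuallyEq (f₁ := l) (by
      filter_upwards [hf.isOpen.mem_nhds hq] with x hx using hl x hx)
    rw [h1.fderiv, hm q hq]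
    simp; ring
  have hm' : ∀ v, fderiv ℝ m q v = l q * fderiv ℝ φ q v := fun v => by
    have h1 := (hdφ.sin.const_mul (Real.sin θ)).congr_of_eventuallyEq (f₁ := m) (by
      filter_upwards [hf.isOpen.mem_nhds hq] with x hx using hm x hx)
    rw [h1.fderiv, hl q hq]
    simp; ring
  obtain ⟨hd, hd'⟩ := fderiv_frameComb (C := ε * Real.cos θ) hdf hdl hdm
  -- Turning `φ` moves the conormal in the direction `(0, -m, l)`. Pairing with this `w` yields
  -- `sin² θ · T φ`, while the derivative of `φ` along `w` drops out because `T` has last components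
  -- proportional to `(l, m)`.
  obtain ⟨w, hw2, hw3⟩ := h.transverse q hq (-m q) (l q)
  have key := inner_fderiv_symm hf.isOpen hf.smooth h.normal hq hd τ w
  have ew := frame_expansion (hf.norm q hq) (hf.tangent hq w)
  set y := inner ℝ (fderiv ℝ f q w) (hopfField (f q)) with hy
  rw [hw2, hw3] at ew
  change _ = frameComb y (-m q) (l q) (f q) at ew
  have hτ' : fderiv ℝ f q τ = frameComb (ε⁻¹ * Real.sin θ ^ 2) (-(Real.cos θ * l q))
      (-(Real.cos θ * m q)) (f q) := by
    have : fderiv ℝ f q τ = ε⁻¹ • (ε • fderiv ℝ f q τ) := by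
      rw [smul_smul, inv_mul_cancel₀ hε.ne', one_smul]
    rw [this, hτ]
    simp only [frameComb, smul_add, smul_smul]
    congr 3 <;> field_simp
  rw [hd', hd', hl', hm', hl', hm', inner_add_right, inner_add_right, hτ', ew,
    inner_frameComb_frameComb (hf.norm q hq), inner_frameComb_frameComb (hf.norm q hq)] at key
  simp only [frameComb] at key
  rw [inner_frame (hf.norm q hq), inner_frame (hf.norm q hq)] at key
  have hs2 := h.sq_add_sq q hq
  have hss : Real.sin θ ^ 2 ≠ 0 := pow_ne_zero 2 hs
  apply mul_left_cancel₀ hss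
  rw [constB_eq]
  have hi : ε * ε⁻¹ = 1 := mul_inv_cancel₀ hε.ne'
  linear_combination ε * key - (ε * fderiv ℝ φ q τ + 2 * (ε * Real.cos θ) ^ 2 +
    2 * Real.sin θ ^ 2) * hs2 - 2 * Real.sin θ ^ 2 * (l q ^ 2 + m q ^ 2) * hi

/-! ### Adapted coordinates -/

/-- The first row of the special unitary matrix which maps `x` to `p`, for unit vectors. -/
def rowsOf (p x : R4) : R4 :=
  !₂[p 0 * x 0 + p 1 * x 1 + p 2 * x 2 + p 3 * x 3,
    -p 1 * x 0 + p 0 * x 1 - p 2 * x 3 + p 3 * x 2,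
    p 0 * x 2 + p 1 * x 3 - p 2 * x 0 - p 3 * x 1,
    -p 1 * x 2 + p 0 * x 3 + p 2 * x 1 - p 3 * x 0]

noncomputable def rowsOfL : R4 →L[ℝ] R4 →L[ℝ] R4 :=
  LinearMap.toContinuousBilinearMap (LinearMap.mk₂ ℝ rowsOf
    (by intros; ext i; fin_cases i <;> simp [rowsOf] <;> ring)
    (by intros; ext i; fin_cases i <;> simp [rowsOf] <;> ring)
    (by intros; ext i; fin_cases i <;> simp [rowsOf] <;> ring)
    (by intros; ext i; fin_cases i <;> simp [rowsOf] <;> ring))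

theorem rowsOfL_apply (p x : R4) : rowsOfL p x = rowsOf p x := rfl

theorem rowsApply_rowsOf {p x : R4} (hx : inner ℝ x x = 1) :
    rowsApply (Real.pi / 2) (rowsOf p x) x = p := by
  rw [inner_R4] at hx
  ext i
  fin_cases i <;> simp [rowsApply, rowsOf]
  · linear_combination p 0 * hx
  · linear_combination p 1 * hx
  · linear_combination p 2 * hx
  · linear_combination p 3 * hx

theorem inner_rowsOf (p x : R4) :
    inner ℝ (rowsOf p x) (rowsOf p x) = inner ℝ p p * inner ℝ x x := by
  simp only [inner_R4]
  simp [rowsOf]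
  ring

/-- The entries of `rowsOf p x` are products of `p` with `x` multiplied by units commuting with the
frame operators, and those operators are skew. So if `p` and `x` move with the same frame
components, the matrix taking `x` to `p` is stationary. -/
theorem rowsOf_frameComb (a b c : ℝ) (p x : R4) :
    rowsOf p (frameComb a b c x) + rowsOf (frameComb a b c p) x = 0 := by
  ext i
  fin_cases i <;> simp [rowsOf, frameComb, hopfField_eq, frame2, frame3] <;> ring

/-- At `ξ = π/2` the matrix commutes with all three of `J₁, J₂, J₃`, not with `J₁` alone. This is
why the direct part uses that constant. -/
theorem rowsApply_frameComb (a b c : ℝ) (r x : R4) :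
    rowsApply (Real.pi / 2) r (frameComb a b c x) =
      frameComb a b c (rowsApply (Real.pi / 2) r x) := by
  ext i
  fin_cases i <;> simp [rowsApply, frameComb, hopfField_eq, frame2, frame3] <;> ring

section

variable {ε θ : ℝ}

theorem sin_nonneg_of_mem (hθ : θ ∈ Set.Ico 0 (Real.pi / 2)) : 0 ≤ Real.sin θ :=
  Real.sin_nonneg_of_nonneg_of_le_pi hθ.1 (by linarith [hθ.2, Real.pi_pos])

theorem sqrt_g11_mul_sqrt_g33 (hε : 0 < ε) (hθ : θ ∈ Set.Ico 0 (Real.pi / 2)) :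
    2 * √(constB ε θ) * (√(g11 ε θ) * √(g33 ε θ)) = Real.sin θ := by
  rw [← sq_eq_sq₀ (by positivity) (sin_nonneg_of_mem hθ)]
  have h1 := Real.sq_sqrt (g11_nonneg hε hθ)
  have h2 := Real.sq_sqrt (g33_nonneg hε hθ)
  have h3 := g11_eq hε hθ
  have h4 := g33_eq hε hθ
  have h5 := sq_sqrt_constB hε hθ
  set b := √(constB ε θ)
  have : (2 * b * (√(g11 ε θ) * √(g33 ε θ))) ^ 2 = (2 * b * √(g11 ε θ) ^ 2) *
    (2 * b * √(g33 ε θ) ^ 2) := by ring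
  rw [this, h1, h2, h3, h4]
  linear_combination h5

theorem alpha_add (hε : 0 < ε) : ε * (alpha1 ε θ + alpha2 ε θ) = 2 * constB ε θ := by
  rw [alpha1, alpha2]; field_simp; ring

/-- The components of the velocity of `β` in the quaternionic frame. -/
theorem betaVel_eq_frameComb (hε : 0 < ε) (hθ : θ ∈ Set.Ico 0 (Real.pi / 2)) (u : ℝ) :
    ε • betaVel ε θ u = frameComb (Real.sin θ ^ 2)
      (-(ε * Real.cos θ * (Real.sin θ * Real.cos ((alpha1 ε θ + alpha2 ε θ) * u))))
      (-(ε * Real.cos θ * -(Real.sin θ * Real.sin ((alpha1 ε θ + alpha2 ε θ) * u))))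
      (beta ε θ u) := by
  have h1 := alpha1_eq hε hθ
  have h2 := alpha2_eq hε hθ
  have h01 := beta_sq01 hε hθ u
  have h23 := beta_sq23 hε hθ u
  have hg11 := g11_eq hε hθ
  have hg33 := g33_eq hε hθ
  have hbb := sq_sqrt_constB hε hθ
  have hgg := sqrt_g11_mul_sqrt_g33 hε hθ
  -- The pair on the left is `2√B` times the conjugate of `z w` along `β`, since the arguments of
  -- `z` and `w` add up to `(α₁ + α₂) u`. The frame identity thereby becomes polynomial in the
  -- coordinates of `β`.
  have hl : Real.sin θ * Real.cos ((alpha1 ε θ + alpha2 ε θ) * u) = 2 * √(constB ε θ) *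
      (beta ε θ u 0 * beta ε θ u 2 - beta ε θ u 1 * beta ε θ u 3) := by
    rw [← hgg, add_mul, Real.cos_add]; simp [beta]; ring
  have hm : -(Real.sin θ * Real.sin ((alpha1 ε θ + alpha2 ε θ) * u)) = -(2 * √(constB ε θ) *
      (beta ε θ u 0 * beta ε θ u 3 + beta ε θ u 1 * beta ε θ u 2)) := by
    rw [← hgg, add_mul, Real.sin_add]; simp [beta]; ring
  generalize Real.sin θ * Real.cos ((alpha1 ε θ + alpha2 ε θ) * u) = l at *
  generalize -(Real.sin θ * Real.sin ((alpha1 ε θ + alpha2 ε θ) * u)) = m at *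
  rw [betaVel]
  generalize beta ε θ u = y at *
  set b := √(constB ε θ)
  set C := ε * Real.cos θ
  ext i
  fin_cases i <;> simp [frameComb, hopfField_eq, frame2, frame3]
  · linear_combination (-y 1) * h1 - C * y 3 * hl - C * y 2 * hm + 2 * b * C * y 1 * h23 +
      C * y 1 * hg33 - y 1 * hbb
  · linear_combination y 0 * h1 - C * y 2 * hl + C * y 3 * hm - 2 * b * C * y 0 * h23 -
      C * y 0 * hg33 + y 0 * hbb
  · linear_combination (-y 3) * h2 + C * y 1 * hl + C * y 0 * hm - 2 * b * C * y 3 * h01 -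
      C * y 3 * hg11 - y 3 * hbb
  · linear_combination y 2 * h2 + C * y 0 * hl - C * y 1 * hm + 2 * b * C * y 2 * h01 +
      C * y 2 * hg11 + y 2 * hbb

/-! ### Moving frames constant along the tangential part of the Hopf field -/

/-- A local description of a helix surface as `A β(u)`, where `r` is the first row of `A`. -/
structure IsMovingFrame (ε θ : ℝ) (V : Set R2) (f : R2 → R4) (u : R2 → ℝ) (r : R2 → R4) :
    Prop where
  isOpen : IsOpen V
  smooth_left : ContDiffOn ℝ ∞ u V
  smooth_right : ContDiffOn ℝ ∞ r V
  norm : ∀ q ∈ V, inner ℝ (r q) (r q) = 1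
  eq : ∀ q ∈ V, f q = rowsApply (Real.pi / 2) (r q) (beta ε θ (u q))
  fderiv_eq : ∀ q ∈ V, ∀ w, fderiv ℝ f q w =
    fderiv ℝ u q w • rowsApply (Real.pi / 2) (r q) (betaVel ε θ (u q)) +
      rowsApply (Real.pi / 2) (fderiv ℝ r q w) (beta ε θ (u q))
  tangent : ∀ q ∈ V, ∃ τ, fderiv ℝ u q τ = 1 ∧ fderiv ℝ r q τ = 0
  immersion : ∀ q ∈ V, ∀ w, fderiv ℝ u q w = 0 → fderiv ℝ r q w = 0 → w = 0
  normal : ∀ q ∈ V, ∀ w, inner ℝ (fderiv ℝ f q w) (rowsApply (Real.pi / 2) (r q)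
    !₂[-beta ε θ (u q) 1, beta ε θ (u q) 0, beta ε θ (u q) 3, -beta ε θ (u q) 2]) = 0

variable {W V : Set R2} {f : R2 → R4}

theorem IsHelixPatch.mono (hf : IsHelixPatch ε θ W f) (hV : IsOpen V) (h : V ⊆ W) :
    IsHelixPatch ε θ V f :=
  ⟨hV, hf.smooth.mono h, fun q hq => hf.norm q (h hq), fun q hq => hf.immersion q (h hq),
    fun q hq => hf.angle q (h hq)⟩

theorem IsNormalPair.mono {l m : R2 → ℝ} (hf : IsNormalPair ε θ W f l m) (h : V ⊆ W) :
    IsNormalPair ε θ V f l m :=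
  ⟨hf.smooth_left.mono h, hf.smooth_right.mono h, fun q hq => hf.sq_add_sq q (h hq),
    fun q hq => hf.normal q (h hq), fun q hq => hf.transverse q (h hq)⟩

theorem IsHelixPatch.exists_movingFrame (hε : 0 < ε) (hθ : θ ∈ Set.Ico 0 (Real.pi / 2))
    (hf : IsHelixPatch ε θ W f) {q₀ : R2} (hq₀ : q₀ ∈ W) :
    ∃ V u r, q₀ ∈ V ∧ V ⊆ W ∧ IsMovingFrame ε θ V f u r := by
  obtain ⟨l, m, hlm⟩ := hf.exists_normalPair hε hθ
  have hs : Real.sin θ ≠ 0 := hlm.sin_ne_zero hε hθ hf hq₀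
  have hs0 : 0 < Real.sin θ := lt_of_le_of_ne (sin_nonneg_of_mem hθ) hs.symm
  have hnorm : ∀ q ∈ W, ‖(⟨l q, m q⟩ : ℂ)‖ = Real.sin θ := fun q hq => by
    rw [Complex.norm_eq_sqrt_sq_add_sq, hlm.sq_add_sq q hq, Real.sqrt_sq hs0.le]
  have hc : ContDiffOn ℝ ∞ (fun q => (⟨l q, m q⟩ : ℂ)) W := by
    have h := ((Complex.ofRealCLM.contDiff.comp_contDiffOn hlm.smooth_left).add
      ((Complex.ofRealCLM.contDiff.comp_contDiffOn hlm.smooth_right).mul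
        (contDiffOn_const (c := Complex.I))))
    refine h.congr fun v _ => ?_
    apply Complex.ext <;> simp
  obtain ⟨V, φ, hV, hqV, hVW, hφ, -, hpol⟩ := exists_arg hf.isOpen hq₀ hc
    (by rw [← norm_pos_iff, hnorm q₀ hq₀]; exact hs0)
  have hpol' : ∀ q ∈ V, l q = Real.sin θ * Real.cos (φ q) ∧
      m q = Real.sin θ * Real.sin (φ q) := fun q hq => by
    have h := hpol q hq
    rw [hnorm q (hVW hq), Complex.exp_mul_I, ← Complex.ofReal_cos, ← Complex.ofReal_sin] at h
    have h1 := congrArg Complex.re h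
    have h2 := congrArg Complex.im h
    simp [-Complex.ofReal_cos, -Complex.ofReal_sin] at h1 h2
    exact ⟨h1, h2⟩
  replace hf := hf.mono hV hVW
  replace hlm := hlm.mono hVW
  obtain ⟨κ, hκ⟩ : ∃ κ, κ = alpha1 ε θ + alpha2 ε θ := ⟨_, rfl⟩
  have hκε : ε * κ = 2 * constB ε θ := by rw [hκ, alpha_add hε]
  have hκ0 : κ ≠ 0 := by
    rintro rfl
    have := constB_pos hε hθ
    linarith
  -- Normalised so that `T u = 1`, because `ε T φ = -2B` and `ε κ = 2B`. With this choice `β'` at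
  -- `u` has the frame components of `T`.
  let u : R2 → ℝ := fun q => -(φ q / κ)
  have hu : ContDiffOn ℝ ∞ u V := (hφ.div_const κ).neg
  have hφu : ∀ q, φ q = -(κ * u q) := fun q => by simp only [u]; field_simp
  have hlu : ∀ q ∈ V, l q = Real.sin θ * Real.cos ((alpha1 ε θ + alpha2 ε θ) * u q) := by
    intro q hq
    rw [(hpol' q hq).1, hφu, Real.cos_neg, hκ]
  have hmu : ∀ q ∈ V, m q = -(Real.sin θ * Real.sin ((alpha1 ε θ + alpha2 ε θ) * u q)) := by
    intro q hq
    rw [(hpol' q hq).2, hφu, Real.sin_neg, hκ, mul_neg]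
  have hvel : ∀ q ∈ V, ε • betaVel ε θ (u q) = frameComb (Real.sin θ ^ 2)
      (-(ε * Real.cos θ * l q)) (-(ε * Real.cos θ * m q)) (beta ε θ (u q)) := fun q hq => by
    rw [betaVel_eq_frameComb hε hθ, hlu q hq, hmu q hq]
  let r : R2 → R4 := fun q => rowsOf (f q) (beta ε θ (u q))
  have hdu : ∀ q ∈ V, HasFDerivAt u (fderiv ℝ u q) q := fun q hq =>
    ((hu.contDiffAt (hV.mem_nhds hq)).differentiableAt (by simp)).hasFDerivAt
  have hdf : ∀ q ∈ V, HasFDerivAt f (fderiv ℝ f q) q := fun q hq =>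
    ((hf.smooth.contDiffAt (hV.mem_nhds hq)).differentiableAt (by simp)).hasFDerivAt
  have hdb : ∀ q ∈ V, HasFDerivAt (fun q => beta ε θ (u q)) _ q := fun q hq =>
    (hasDerivAt_beta (ε := ε) (θ := θ) (u q)).hasFDerivAt.comp q (hdu q hq)
  have hr : ContDiffOn ℝ ∞ r V := by
    have h1 := rowsOfL.contDiff.comp_contDiffOn hf.smooth
    exact h1.clm_apply (contDiff_beta.comp_contDiffOn hu)
  have hdr : ∀ q ∈ V, ∀ w, fderiv ℝ r q w = fderiv ℝ u q w • rowsOf (f q) (betaVel ε θ (u q)) +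
      rowsOf (fderiv ℝ f q w) (beta ε θ (u q)) := fun q hq w => by
    have h : HasFDerivAt r _ q := rowsOfL.hasFDerivAt_of_bilinear (hdf q hq) (hdb q hq)
    rw [h.fderiv]
    simp [← rowsOfL_apply]
  have heq : ∀ q ∈ V, f q = rowsApply (Real.pi / 2) (r q) (beta ε θ (u q)) := fun q _ =>
    (rowsApply_rowsOf (inner_beta hε hθ (u q))).symm
  have hfd : ∀ q ∈ V, ∀ w, fderiv ℝ f q w =
      fderiv ℝ u q w • rowsApply (Real.pi / 2) (r q) (betaVel ε θ (u q)) +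
        rowsApply (Real.pi / 2) (fderiv ℝ r q w) (beta ε θ (u q)) := fun q hq w => by
    have hdr' := ((hr.contDiffAt (hV.mem_nhds hq)).differentiableAt (by simp)).hasFDerivAt
    have h := (rowsApplyL (Real.pi / 2)).hasFDerivAt_of_bilinear hdr' (hdb q hq)
    have h' := h.congr_of_eventuallyEq (f₁ := f) (by
      filter_upwards [hV.mem_nhds hq] with x hx using heq x hx)
    rw [h'.fderiv]
    simp [← rowsApplyL_apply]
  refine ⟨V, u, r, hqV, hVW, hV, hu, hr, fun q hq => ?_, heq, hfd, fun q hq => ?_,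
    fun q hq w h1 h2 => ?_, fun q hq w => ?_⟩
  · rw [inner_rowsOf, hf.norm q hq, inner_beta hε hθ, one_mul]
  · obtain ⟨τ, hτ⟩ := hlm.exists_tangent hθ hf hq
    have h1 := hlm.fderiv_angle hε hθ hf hφ (fun q hq => (hpol' q hq).1)
      (fun q hq => (hpol' q hq).2) hq hτ
    have h2 : fderiv ℝ φ q τ = -(κ * fderiv ℝ u q τ) := by
      have := ((hdu q hq).const_mul κ).neg.congr_of_eventuallyEq (f₁ := φ)
        (Filter.Eventually.of_forall hφu)
      rw [this.fderiv]
      simp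
    have h3 : fderiv ℝ u q τ = 1 := by
      rw [h2] at h1
      apply mul_left_cancel₀ (mul_ne_zero hε.ne' hκ0)
      linarith
    refine ⟨τ, h3, ?_⟩
    -- Along `τ` both `f` and `β(u)` evolve by the same frame combination, so `rowsOf_frameComb`
    -- applies.
    have h4 : ε • fderiv ℝ r q τ = 0 := by
      rw [hdr q hq, h3, one_smul, smul_add]
      simp only [← rowsOfL_apply]
      rw [← map_smul, hvel q hq, ← smul_apply, ← map_smul, hτ]
      simp only [rowsOfL_apply]
      exact rowsOf_frameComb _ _ _ _ _
    exact (smul_eq_zero.1 h4).resolve_left hε.ne'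
  · apply hf.immersion q hq
    rw [hfd q hq, h1, h2, map_zero, zero_smul, zero_add, ← rowsApplyL_apply, map_zero]
    rfl
  · have h1 := hlm.normal q hq w
    have h2 := hvel q hq
    rw [betaVel_eq hε hθ] at h2
    have hb := (sqrt_constB_pos hε hθ).ne'
    have hC := (mul_pos hε (cos_pos_of_mem hθ)).ne'
    set z : R4 := !₂[-beta ε θ (u q) 1, beta ε θ (u q) 0, beta ε θ (u q) 3, -beta ε θ (u q) 2]
    -- Comparing the two expressions for `β'` shows that the conormal, pulled back by `A`, is a
    -- multiple of `σβ`.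
    have h3 : frameComb (ε * Real.cos θ) (l q) (m q) (beta ε θ (u q)) =
        (-√(constB ε θ)) • z := by
      have h4 : (ε * Real.cos θ) • (frameComb (ε * Real.cos θ) (l q) (m q) (beta ε θ (u q)) +
          √(constB ε θ) • z) = 0 := by
        have h5 : (ε * Real.cos θ) • frameComb (ε * Real.cos θ) (l q) (m q) (beta ε θ (u q)) =
            constB ε θ • hopfField (beta ε θ (u q)) - frameComb (Real.sin θ ^ 2)
              (-(ε * Real.cos θ * l q)) (-(ε * Real.cos θ * m q)) (beta ε θ (u q)) := by
          rw [constB_eq]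
          simp only [frameComb]
          module
        rw [smul_add, h5, ← h2]
        module
      have h5 := (smul_eq_zero.1 h4).resolve_left hC
      rw [neg_smul]
      exact eq_neg_of_add_eq_zero_left h5
    rw [heq q hq, ← rowsApply_frameComb, h3, ← rowsApplyL_apply, map_smul, real_inner_smul_right] at h1
    exact (mul_eq_zero.1 h1).resolve_left (neg_ne_zero.2 hb)

end

/-! ### Coordinate rectangles and the inverse function theorem -/

/-- An open coordinate rectangle. -/
def rect (a b c d : ℝ) : Set R2 := {x | x 0 ∈ Set.Ioo a b ∧ x 1 ∈ Set.Ioo c d}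

theorem isOpen_rect (a b c d : ℝ) : IsOpen (rect a b c d) := by
  have h : ∀ i, Continuous fun x : R2 => x i := fun i =>
    (EuclideanSpace.proj i : R2 →L[ℝ] ℝ).continuous
  exact (isOpen_Ioo.preimage (h 0)).inter (isOpen_Ioo.preimage (h 1))

theorem exists_rect_subset {W : Set R2} (hW : IsOpen W) {x : R2} (hx : x ∈ W) :
    ∃ a b c d, x ∈ rect a b c d ∧ rect a b c d ⊆ W := by
  let L := EuclideanSpace.equiv (Fin 2) ℝ
  have hO : IsOpen (L.symm ⁻¹' W) := hW.preimage L.symm.continuous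
  obtain ⟨δ, hδ, hball⟩ := Metric.isOpen_iff.1 hO (L x) (by simpa using hx)
  refine ⟨x 0 - δ, x 0 + δ, x 1 - δ, x 1 + δ, ⟨⟨by linarith, by linarith⟩, ⟨by linarith, by linarith⟩⟩,
    fun y hy => ?_⟩
  have : L y ∈ Metric.ball (L x) δ := by
    rw [Metric.mem_ball, dist_pi_lt_iff hδ]
    intro i
    rw [Real.dist_eq, abs_lt]
    fin_cases i
    · have := hy.1
      change -δ < y 0 - x 0 ∧ y 0 - x 0 < δ
      constructor <;> linarith [this.1, this.2]
    · have := hy.2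
      change -δ < y 1 - x 1 ∧ y 1 - x 1 < δ
      constructor <;> linarith [this.1, this.2]
  simpa using hball this

/-- The inverse function theorem, with a coordinate rectangle as target. -/
theorem exists_openPartialHomeomorph {W : Set R2} (hW : IsOpen W) {ψ : R2 → R2}
    (hψ : ContDiffOn ℝ ∞ ψ W) (hinj : ∀ q ∈ W, Function.Injective (fderiv ℝ ψ q)) {q₀ : R2}
    (hq₀ : q₀ ∈ W) : ∃ (e : OpenPartialHomeomorph R2 R2) (a b c d : ℝ), q₀ ∈ e.source ∧
      e.source ⊆ W ∧ (∀ x, e x = ψ x) ∧ e.target = rect a b c d ∧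
      ContDiffOn ℝ ∞ e.symm e.target := by
  have heq : ∀ q ∈ W, ∃ L : R2 ≃L[ℝ] R2, HasFDerivAt ψ (L : R2 →L[ℝ] R2) q := fun q hq => by
    refine ⟨(LinearEquiv.ofInjectiveEndo (fderiv ℝ ψ q : R2 →ₗ[ℝ] R2)
      (hinj q hq)).toContinuousLinearEquiv, ?_⟩
    have h := ((hψ.contDiffAt (hW.mem_nhds hq)).differentiableAt (by simp)).hasFDerivAt
    exact h.congr_fderiv (ContinuousLinearMap.ext fun _ => rfl)
  have hcd : ∀ q ∈ W, ContDiffAt ℝ ∞ ψ q := fun q hq => hψ.contDiffAt (hW.mem_nhds hq)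
  obtain ⟨L₀, hL₀⟩ := heq q₀ hq₀
  let e₁ := ((hcd q₀ hq₀).toOpenPartialHomeomorph ψ hL₀ (by simp)).restrOpen W hW
  have hs₁ : q₀ ∈ e₁.source :=
    ⟨(hcd q₀ hq₀).mem_toOpenPartialHomeomorph_source hL₀ (by simp), hq₀⟩
  have hco : ∀ x, e₁ x = ψ x := fun x => rfl
  obtain ⟨a, b, c, d, hmem, hsub⟩ := exists_rect_subset e₁.open_target (e₁.map_source hs₁)
  -- Restriction acts on the source, so the target is cut down by restricting the inverse.
  let e := (e₁.symm.restrOpen (rect a b c d) (isOpen_rect a b c d)).symm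
  have htar : e.target = rect a b c d := Set.inter_eq_right.2 hsub
  have hsrc : e.source ⊆ W := fun x hx => by
    have h1 : e x ∈ e₁.target ∩ rect a b c d := e.map_source hx
    have h2 : e.symm (e x) = x := e.left_inv hx
    have h3 := e₁.map_target h1.1
    rw [← h2]
    exact h3.2
  refine ⟨e, a, b, c, d, ?_, hsrc, fun x => rfl, htar, fun x hx => ?_⟩
  · have h1 := e.map_target (htar.symm ▸ hmem : e₁ q₀ ∈ e.target)
    have h2 : e.symm (e₁ q₀) = q₀ := e₁.left_inv hs₁
    rwa [h2] at h1
  · have hxW := hsrc (e.map_target hx)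
    obtain ⟨L, hL⟩ := heq _ hxW
    exact (e.contDiffAt_symm hx hL (hcd _ hxW)).contDiffWithinAt

theorem hasDerivAt_R2 {c : ℝ → R2} {c' : R2} {t : ℝ} :
    HasDerivAt c c' t ↔ ∀ i, HasDerivAt (fun s => c s i) (c' i) t := by
  simp only [← hasDerivWithinAt_univ, hasDerivWithinAt_iff_hasFDerivWithinAt,
    hasFDerivWithinAt_euclidean]
  refine forall_congr' fun i => Eq.to_iff ?_
  congr 1

theorem hasDerivAt_horizontal (t v : ℝ) :
    HasDerivAt (fun t => !₂[t, v] : ℝ → R2) (EuclideanSpace.single 0 1) t := by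
  rw [hasDerivAt_R2]
  intro i
  fin_cases i
  · exact (hasDerivAt_id' t).congr_deriv (by simp)
  · simpa using hasDerivAt_const t v

theorem hasDerivAt_vertical (u t : ℝ) :
    HasDerivAt (fun t => !₂[u, t] : ℝ → R2) (EuclideanSpace.single 1 1) t := by
  rw [hasDerivAt_R2]
  intro i
  fin_cases i
  · simpa using hasDerivAt_const t u
  · exact (hasDerivAt_id' t).congr_deriv (by simp)

theorem eq_toLp (x : R2) : x = !₂[x 0, x 1] := by
  ext i; fin_cases i <;> simp

/-! ### Charts adapted to a moving frame -/

variable {ε θ : ℝ} {W V : Set R2} {f : R2 → R4}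

/-- The coordinates `(u, r j)` of a moving frame. -/
theorem IsMovingFrame.exists_chart {u : R2 → ℝ} {r : R2 → R4}
    (h : IsMovingFrame ε θ V f u r) {q₀ : R2} (hq₀ : q₀ ∈ V) :
    ∃ (e : OpenPartialHomeomorph R2 R2) (a b c d : ℝ) (j : Fin 4), q₀ ∈ e.source ∧ e.source ⊆ V ∧
      e.target = rect a b c d ∧ ContDiffOn ℝ ∞ e e.source ∧ ContDiffOn ℝ ∞ e.symm e.target ∧
      ∀ x ∈ e.target, u (e.symm x) = x 0 ∧ r (e.symm x) j = x 1 ∧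
        (∀ w, fderiv ℝ u (e.symm x) (fderiv ℝ e.symm x w) = w 0) ∧
        (∀ w, fderiv ℝ r (e.symm x) (fderiv ℝ e.symm x w) j = w 1) ∧
        fderiv ℝ r (e.symm x) (fderiv ℝ e.symm x (EuclideanSpace.single 0 1)) = 0 := by
  let e0 : R2 := EuclideanSpace.single 0 1
  let e1 : R2 := EuclideanSpace.single 1 1
  have hsingle : ∀ (L : R2 →L[ℝ] ℝ) (a b : ℝ), L !₂[a, b] = a * L e0 + b * L e1 :=
    fun L a b => by simpa using fderiv_R2 L !₂[a, b]
  have hsingle4 : ∀ (L : R2 →L[ℝ] R4) (j : Fin 4) (w : R2),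
      L w j = w 0 * L e0 j + w 1 * L e1 j := fun L j w => by
    rw [fderiv_R2 L w]; simp [e0, e1]
  obtain ⟨τ₀, hτ₀, -⟩ := h.tangent q₀ hq₀
  -- A generator of the kernel of `du`. Since `du` and `dr` have no common kernel, some entry `r j`
  -- varies along it and completes `u` to coordinates.
  let w₀ : R2 := !₂[-fderiv ℝ u q₀ e1, fderiv ℝ u q₀ e0]
  have hw₀ : fderiv ℝ r q₀ w₀ ≠ 0 := by
    intro h0
    have h1 := h.immersion q₀ hq₀ w₀ (by rw [hsingle]; ring) h0
    have h2 : fderiv ℝ u q₀ e1 = 0 := by simpa [w₀] using congrArg (fun y : R2 => y 0) h1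
    have h3 : fderiv ℝ u q₀ e0 = 0 := by simpa [w₀] using congrArg (fun y : R2 => y 1) h1
    rw [eq_toLp τ₀, hsingle, h2, h3] at hτ₀
    simp at hτ₀
  obtain ⟨j, hj⟩ : ∃ j, fderiv ℝ r q₀ w₀ j ≠ 0 := by
    by_contra hcon
    push Not at hcon
    exact hw₀ (by ext i; exact hcon i)
  let D : R2 → ℝ := fun q => fderiv ℝ u q e0 * fderiv ℝ r q e1 j - fderiv ℝ u q e1 * fderiv ℝ r q e0 j
  have hdu := h.smooth_left.continuousOn_fderiv_of_isOpen h.isOpen (by simp)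
  have hdr := h.smooth_right.continuousOn_fderiv_of_isOpen h.isOpen (by simp)
  have hcoord : Continuous fun x : R4 => x j := (EuclideanSpace.proj j : R4 →L[ℝ] ℝ).continuous
  have hD : ContinuousOn D V :=
    ((hdu.clm_apply continuousOn_const).mul
      (hcoord.comp_continuousOn (hdr.clm_apply continuousOn_const))).sub
    ((hdu.clm_apply continuousOn_const).mul
      (hcoord.comp_continuousOn (hdr.clm_apply continuousOn_const)))
  have hV' : IsOpen (V ∩ D ⁻¹' {0}ᶜ) := hD.isOpen_inter_preimage h.isOpen isOpen_compl_singleton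
  have hq₀' : q₀ ∈ V ∩ D ⁻¹' {0}ᶜ := by
    refine ⟨hq₀, ?_⟩
    rw [hsingle4] at hj
    simp only [w₀] at hj
    simp only [D, Set.mem_preimage, Set.mem_compl_iff, Set.mem_singleton_iff]
    intro h0
    apply hj
    simp
    linarith
  let ψ : R2 → R2 := fun q => !₂[u q, r q j]
  have hrj : ContDiffOn ℝ ∞ (fun q => r q j) V := contDiffOn_euclidean.1 h.smooth_right j
  have hψ : ContDiffOn ℝ ∞ ψ V := by
    rw [contDiffOn_euclidean]
    intro i
    fin_cases i
    exacts [h.smooth_left, hrj]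
  have hψd : ∀ q ∈ V, ∀ w, fderiv ℝ ψ q w = !₂[fderiv ℝ u q w, fderiv ℝ r q w j] := by
    intro q hq w
    have hd := ((hψ.contDiffAt (h.isOpen.mem_nhds hq)).differentiableAt (by simp)).hasFDerivAt
    have hd1 := ((h.smooth_left.contDiffAt (h.isOpen.mem_nhds hq)).differentiableAt
      (by simp)).hasFDerivAt
    have hd2 := ((h.smooth_right.contDiffAt (h.isOpen.mem_nhds hq)).differentiableAt
      (by simp)).hasFDerivAt
    have k0 := ((EuclideanSpace.proj 0 : R2 →L[ℝ] ℝ).hasFDerivAt.comp q hd).unique hd1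
    have k1 := ((EuclideanSpace.proj 1 : R2 →L[ℝ] ℝ).hasFDerivAt.comp q hd).unique
      ((EuclideanSpace.proj j : R4 →L[ℝ] ℝ).hasFDerivAt.comp q hd2)
    ext i
    fin_cases i
    · exact congrArg (fun L : R2 →L[ℝ] ℝ => L w) k0
    · exact congrArg (fun L : R2 →L[ℝ] ℝ => L w) k1
  have hinj : ∀ q ∈ V ∩ D ⁻¹' {0}ᶜ, Function.Injective (fderiv ℝ ψ q) := by
    intro q hq
    rw [injective_iff_map_eq_zero]
    intro w hw
    rw [hψd q hq.1] at hw
    have h0 : fderiv ℝ u q w = 0 := by simpa using congrArg (fun y : R2 => y 0) hw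
    have h1 : fderiv ℝ r q w j = 0 := by simpa using congrArg (fun y : R2 => y 1) hw
    rw [eq_toLp w, hsingle] at h0
    rw [hsingle4] at h1
    have hDq : D q ≠ 0 := hq.2
    have k0 : D q * w 0 = 0 := by
      simp only [D]
      linear_combination fderiv ℝ r q e1 j * h0 - fderiv ℝ u q e1 * h1
    have k1 : D q * w 1 = 0 := by
      simp only [D]
      linear_combination (-fderiv ℝ r q e0 j) * h0 + fderiv ℝ u q e0 * h1
    ext i
    fin_cases i
    · exact (mul_eq_zero.1 k0).resolve_left hDq
    · exact (mul_eq_zero.1 k1).resolve_left hDq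
  obtain ⟨e, a, b, c, d, hq₀e, hsrc, hco, htar, hsm⟩ := exists_openPartialHomeomorph hV'
    (hψ.mono Set.inter_subset_left) hinj hq₀'
  have hsrcV : e.source ⊆ V := fun x hx => (hsrc hx).1
  refine ⟨e, a, b, c, d, j, hq₀e, hsrcV, htar, (hψ.mono hsrcV).congr fun x _ => hco x, hsm,
    fun x hx => ?_⟩
  have hx' := hsrc (e.map_target hx)
  have hright : ∀ y ∈ e.target, ψ (e.symm y) = y := fun y hy => by
    rw [← hco]; exact e.right_inv hy
  have hsx := ((hsm.contDiffAt (e.open_target.mem_nhds hx)).differentiableAt (by simp)).hasFDerivAt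
  have hψx := ((hψ.contDiffAt (h.isOpen.mem_nhds hx'.1)).differentiableAt (by simp)).hasFDerivAt
  have hid := (hψx.comp x hsx).unique ((hasFDerivAt_id x).congr_of_eventuallyEq (by
    filter_upwards [e.open_target.mem_nhds hx] with y hy using hright y hy))
  have hid' : ∀ w, fderiv ℝ ψ (e.symm x) (fderiv ℝ e.symm x w) = w := fun w =>
    congrArg (fun L : R2 →L[ℝ] R2 => L w) hid
  have hx0 := hright x hx
  refine ⟨by simpa [ψ] using congrArg (fun y : R2 => y 0) hx0,
    by simpa [ψ] using congrArg (fun y : R2 => y 1) hx0, fun w => ?_, fun w => ?_, ?_⟩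
  · have := hid' w
    rw [hψd _ hx'.1] at this
    simpa using congrArg (fun y : R2 => y 0) this
  · have := hid' w
    rw [hψd _ hx'.1] at this
    simpa using congrArg (fun y : R2 => y 1) this
  · obtain ⟨τ, hτ1, hτ2⟩ := h.tangent _ hx'.1
    -- The coordinate vector of `u` and `τ` have the same image `(1, 0)` under `d(u, r j)`, so they
    -- coincide and `r` does not change along it.
    have : fderiv ℝ e.symm x (EuclideanSpace.single 0 1) = τ := by
      apply hinj _ hx'
      rw [hid', hψd _ hx'.1, hτ1, hτ2]
      ext i
      fin_cases i <;> simp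
    rw [this, hτ2]

/-- As `∂_u r = 0` on a rectangle, `r` is a curve `Y(v)`. It is regular because its entry `j` is `v`
itself, and orthogonality of `df` to `A σβ` is its differential equation, so `exists_admissible`
supplies the angles after shrinking the `v`-interval. -/
theorem IsMovingFrame.exists_coordinates (hε : 0 < ε) (hθ : θ ∈ Set.Ico 0 (Real.pi / 2))
    {u : R2 → ℝ} {r : R2 → R4} (h : IsMovingFrame ε θ V f u r) {q₀ : R2} (hq₀ : q₀ ∈ V) :
    ∃ (e : OpenPartialHomeomorph R2 R2) (a b c d : ℝ) (ξ₁ ξ₂ ξ₃ : ℝ → ℝ), q₀ ∈ e.source ∧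
      e.source ⊆ V ∧ e.target = rect a b c d ∧ ContDiffOn ℝ ∞ e e.source ∧
      ContDiffOn ℝ ∞ e.symm e.target ∧
      IsAdmissible (Set.Ioo c d) (fun _ => Real.pi / 2) ξ₁ ξ₂ ξ₃ ∧
      ∀ x ∈ e.target, f (e.symm x) = helixMap ε θ (fun _ => Real.pi / 2) ξ₁ ξ₂ ξ₃ x := by
  obtain ⟨e, a, b, c, d, j, hqe, hsrc, htar, hsm, hsm', hx⟩ := h.exists_chart hq₀
  have hmem : e q₀ ∈ rect a b c d := htar ▸ e.map_source hqe
  let u₀ := e q₀ 0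
  have hu₀ : u₀ ∈ Set.Ioo a b := hmem.1
  have hin : ∀ s ∈ Set.Ioo a b, ∀ v ∈ Set.Ioo c d, (!₂[s, v] : R2) ∈ e.target := fun s hs v hv => by
    rw [htar]; exact ⟨hs, hv⟩
  let Y : ℝ → R4 := fun v => r (e.symm !₂[u₀, v])
  have hrs : ContDiffOn ℝ ∞ (fun x => r (e.symm x)) e.target :=
    h.smooth_right.comp hsm' fun x hx => hsrc (e.map_target hx)
  have hrd : ∀ x ∈ e.target, HasFDerivAt (fun x => r (e.symm x))
      ((fderiv ℝ r (e.symm x)).comp (fderiv ℝ e.symm x)) x := fun x hx => by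
    have h1 := ((hsm'.contDiffAt (e.open_target.mem_nhds hx)).differentiableAt
      (by simp)).hasFDerivAt
    have h2 := ((h.smooth_right.contDiffAt (h.isOpen.mem_nhds
      (hsrc (e.map_target hx)))).differentiableAt (by simp)).hasFDerivAt
    exact h2.comp x h1
  have hYs : ContDiffOn ℝ ∞ Y (Set.Ioo c d) := by
    refine hrs.comp (f := fun v => (!₂[u₀, v] : R2)) ?_ fun v hv => hin u₀ hu₀ v hv
    rw [contDiffOn_euclidean]
    intro i
    fin_cases i
    exacts [contDiffOn_const, contDiffOn_id]
  have hYd : ∀ v ∈ Set.Ioo c d, HasDerivAt Y (fderiv ℝ r (e.symm !₂[u₀, v])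
      (fderiv ℝ e.symm !₂[u₀, v] (EuclideanSpace.single 1 1))) v := fun v hv => by
    have := (hrd _ (hin u₀ hu₀ v hv)).comp_hasDerivAt v (hasDerivAt_vertical u₀ v)
    exact this
  have hconst : ∀ x ∈ e.target, r (e.symm x) = Y (x 1) := by
    intro x hxt
    have hx' : x ∈ rect a b c d := htar ▸ hxt
    have hder : ∀ s ∈ Set.Ioo a b, HasDerivAt (fun s => r (e.symm !₂[s, x 1])) 0 s := by
      intro s hs
      have hst := hin s hs _ hx'.2
      have := (hrd _ hst).comp_hasDerivAt s (hasDerivAt_horizontal s (x 1))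
      rw [ContinuousLinearMap.comp_apply, (hx _ hst).2.2.2.2] at this
      exact this
    have := isOpen_Ioo.is_const_of_deriv_eq_zero isPreconnected_Ioo
      (fun s hs => (hder s hs).differentiableAt.differentiableWithinAt)
      (fun s hs => (hder s hs).deriv) hx'.1 hu₀
    rw [← eq_toLp x] at this
    exact this
  obtain ⟨c', d', ξ₁, ξ₂, ξ₃, hv₀, hsub, hadm, hrow⟩ := exists_admissible isOpen_Ioo hmem.2 hYs
    (fun v hv => h.norm _ (hsrc (e.map_target (hin u₀ hu₀ v hv)))) (fun v hv => by
      have hst := hin u₀ hu₀ v hv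
      have hV := hsrc (e.map_target hst)
      have h1 := h.normal _ hV (fderiv ℝ e.symm !₂[u₀, v] (EuclideanSpace.single 1 1))
      rw [h.fderiv_eq _ hV, (hx _ hst).2.2.1, ← (hYd v hv).deriv] at h1
      simp only [PiLp.single_apply, Fin.isValue, zero_ne_one, if_false, zero_smul, zero_add] at h1
      rw [inner_rowsApply_conj, inner_beta hε hθ] at h1
      change (Y v 1 * deriv Y v 0 - Y v 0 * deriv Y v 1 - (Y v 3 * deriv Y v 2 -
        Y v 2 * deriv Y v 3)) * 1 = 0 at h1
      linarith) (fun h0 => by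
      have h1 := (hx _ (hin u₀ hu₀ _ hmem.2)).2.2.2.1 (EuclideanSpace.single 1 1)
      rw [← (hYd _ hmem.2).deriv, h0] at h1
      simp at h1) (Real.pi / 2)
  have hsubR : rect a b c' d' ⊆ e.target := fun x hx => by
    rw [htar]; exact ⟨hx.1, hsub hx.2⟩
  let e' := (e.symm.restrOpen (rect a b c' d') (isOpen_rect a b c' d')).symm
  have htar' : e'.target = rect a b c' d' := Set.inter_eq_right.2 hsubR
  have hsrc' : e'.source ⊆ e.source := fun x hx => by
    have h1 : e' x ∈ e.target ∩ rect a b c' d' := e'.map_source hx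
    have h2 : e'.symm (e' x) = x := e'.left_inv hx
    have h3 := e.map_target h1.1
    rw [← h2]
    exact h3
  refine ⟨e', a, b, c', d', ξ₁, ξ₂, ξ₃, ?_, hsrc'.trans hsrc, htar', hsm.mono hsrc',
    hsm'.mono (htar'.trans_subset hsubR), hadm, fun x hx' => ?_⟩
  · have h1 := e'.map_target (htar'.symm ▸ ⟨hmem.1, hv₀⟩ : e q₀ ∈ e'.target)
    have h2 : e'.symm (e q₀) = q₀ := e.left_inv hqe
    rwa [h2] at h1
  · have hxR : x ∈ rect a b c' d' := htar' ▸ hx'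
    have hxt := hsubR hxR
    change f (e.symm x) = _
    rw [h.eq _ (hsrc (e.map_target hxt)), (hx x hxt).1, hconst x hxt, hrow _ hxR.2, helixMap_eq]

/-! ### Passage to manifolds -/

section Manifolds

variable {M : Type*} [TopologicalSpace M] [ChartedSpace R2 M]
  {e : OpenPartialHomeomorph M R2} {f : M → R4}

theorem mDifferentiable_of_mem_maximalAtlas (he : e ∈ IsManifold.maximalAtlas (𝓡 2) ∞ M) :
    e.MDifferentiable (𝓡 2) (𝓡 2) :=
  ⟨(contMDiffOn_of_mem_maximalAtlas he).mdifferentiableOn (by simp),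
    (contMDiffOn_symm_of_mem_maximalAtlas he).mdifferentiableOn (by simp)⟩

theorem push_mfderiv_symm [IsManifold (𝓡 2) ∞ M]
    (he : e ∈ IsManifold.maximalAtlas (𝓡 2) ∞ M)
    (hf : ContMDiff (𝓡 2) 𝓘(ℝ, R4) ∞ f) {x : R2} (hx : x ∈ e.target) (w : R2) :
    push f (e.symm x) (mfderiv (𝓡 2) (𝓡 2) e.symm x w) = fderiv ℝ (f ∘ e.symm) x w := by
  have h1 := (mDifferentiable_of_mem_maximalAtlas he).mdifferentiableAt_symm hx
  have h2 : MDifferentiableAt (𝓡 2) 𝓘(ℝ, R4) f (e.symm x) :=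
    (hf (e.symm x)).mdifferentiableAt (by simp)
  rw [← mfderiv_eq_fderiv, mfderiv_comp x h2 h1]
  rfl

theorem mfderiv_symm_bijective [IsManifold (𝓡 2) ∞ M]
    (he : e ∈ IsManifold.maximalAtlas (𝓡 2) ∞ M) {x : R2}
    (hx : x ∈ e.target) : Function.Bijective (mfderiv (𝓡 2) (𝓡 2) e.symm x) :=
  (mDifferentiable_of_mem_maximalAtlas he).symm.mfderiv_bijective hx

theorem IsHelixSurface.isHelixPatch [IsManifold (𝓡 2) ∞ M] {ε θ : ℝ} (hf : IsHelixSurface ε θ f)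
    (he : e ∈ IsManifold.maximalAtlas (𝓡 2) ∞ M) :
    IsHelixPatch ε θ e.target (f ∘ e.symm) := by
  have hpush := fun {x : R2} (hx : x ∈ e.target) => push_mfderiv_symm he hf.smooth hx
  refine ⟨e.open_target, ?_, fun q hq => ?_, fun q hq => ?_, fun q hq n h1 h2 h3 => ?_⟩
  · exact (hf.smooth.comp_contMDiffOn (contMDiffOn_symm_of_mem_maximalAtlas he)).contDiffOn
  · have := (mem_sphere_iff _).1 (hf.mem_sphere (e.symm q))
    rw [inner_R4]
    simp only [Function.comp_apply]
    linarith
  · intro w w' hw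
    rw [← hpush hq, ← hpush hq] at hw
    exact (mfderiv_symm_bijective he hq).1 (hf.immersion _ hw)
  · refine hf.angle _ n ⟨h1, fun w => ?_, h3⟩
    obtain ⟨w', rfl⟩ := (mfderiv_symm_bijective he hq).2 w
    exact (congrArg (bergerMetric ε (f (e.symm q)) n) (hpush hq w')).trans (h2 w')

end Manifolds

/-- The preferred chart of an open subset of the plane is the inclusion, so in charts the map is `f`
itself near `x`. -/
theorem mfderiv_comp_subtype_val {U : TopologicalSpace.Opens R2} {f : R2 → R4} {x : U}
    (hf : ContMDiffAt (𝓡 2) 𝓘(ℝ, R4) ∞ (fun y : U => f y) x) (w : R2) :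
    mfderiv (𝓡 2) 𝓘(ℝ, R4) (fun y : U => f y) x w = fderiv ℝ f x w := by
  rw [(hf.mdifferentiableAt (by simp)).mfderiv]
  have h := U.chartAt_subtype_val_symm_eventuallyEq (H := R2) (x := x)
  have h2 : writtenInExtChartAt (𝓡 2) 𝓘(ℝ, R4) x (fun y : U => f y) =ᶠ[nhds (x : R2)] f := by
    filter_upwards [h] with y hy
    simp only [writtenInExtChartAt, mfld_simps]
    exact congrArg f hy.symm
  simp only [mfld_simps, fderivWithin_univ]
  have h3 : chartAt R2 x x = (x : R2) := rfl
  rw [h3]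
  exact congrArg (fun L : R2 →L[ℝ] R4 => L w) h2.fderiv_eq

end BergerHelix

theorem theorem3p1 (ε θ : ℝ) (hε : 0 < ε) (hθ : θ ∈ Set.Ico 0 (Real.pi / 2)) :
    -- every helix surface is locally of the stated form
    (∀ (M : Type*) [TopologicalSpace M] [ChartedSpace BergerHelix.R2 M] [IsManifold (𝓡 2) ∞ M]
        (f : M → BergerHelix.R4), BergerHelix.IsHelixSurface ε θ f → ∀ p : M,
      (0 < BergerHelix.g11 ε θ ∧ 0 < BergerHelix.g33 ε θ ∧
        BergerHelix.torus (√(BergerHelix.g11 ε θ)) (√(BergerHelix.g33 ε θ)) ⊆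
          Metric.sphere (0 : BergerHelix.R4) 1 ∧
        BergerHelix.IsGeodesicOf
          (BergerHelix.torus (√(BergerHelix.g11 ε θ)) (√(BergerHelix.g33 ε θ)))
          (BergerHelix.beta ε θ)) ∧
      ∃ (e : OpenPartialHomeomorph M BergerHelix.R2) (a b c d : ℝ) (ξ ξ₁ ξ₂ ξ₃ : ℝ → ℝ),
        e ∈ IsManifold.maximalAtlas (𝓡 2) ∞ M ∧ p ∈ e.source ∧
        e.target = {x | x 0 ∈ Set.Ioo a b ∧ x 1 ∈ Set.Ioo c d} ∧
        -- the coordinates are adapted: the coordinate field of `u` is `T`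
        (∀ x ∈ e.target, BergerHelix.IsHopfTangentPart ε f (e.symm x)
          (mfderiv (𝓡 2) (𝓡 2) e.symm x (EuclideanSpace.single 0 1 : BergerHelix.R2))) ∧
        BergerHelix.IsAdmissible (Set.Ioo c d) ξ ξ₁ ξ₂ ξ₃ ∧
        (∀ v ∈ Set.Ioo c d,
          BergerHelix.matA (ξ v) (ξ₁ v) (ξ₂ v) (ξ₃ v) ∈ Matrix.orthogonalGroup (Fin 4) ℝ ∧
          Commute (BergerHelix.matA (ξ v) (ξ₁ v) (ξ₂ v) (ξ₃ v)) BergerHelix.J1) ∧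
        (∀ x ∈ e.target, f (e.symm x) = BergerHelix.helixMap ε θ ξ ξ₁ ξ₂ ξ₃ x)) ∧
    -- conversely, wherever it is an immersion, such a map is a helix surface
    (∀ (I : Set ℝ) (ξ ξ₁ ξ₂ ξ₃ : ℝ → ℝ), IsOpen I → I.OrdConnected →
      BergerHelix.IsAdmissible I ξ ξ₁ ξ₂ ξ₃ →
      ∀ U : TopologicalSpace.Opens BergerHelix.R2, (∀ x ∈ U, x 1 ∈ I) →
        (∀ x ∈ U, Function.Injective
          (fderiv ℝ (BergerHelix.helixMap ε θ ξ ξ₁ ξ₂ ξ₃) x)) →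
        BergerHelix.IsHelixSurface ε θ
          (fun x : U => BergerHelix.helixMap ε θ ξ ξ₁ ξ₂ ξ₃ x)) := by
  open BergerHelix in
  refine ⟨fun M _ _ _ f hf p => ?_, fun I ξ ξ₁ ξ₂ ξ₃ hI _ hadm U hU hinj => ?_⟩
  · have he₀ := IsManifold.chart_mem_maximalAtlas (I := 𝓡 2) (n := ∞) p
    set e₀ := chartAt R2 p
    have hp₀ : p ∈ e₀.source := mem_chart_source R2 p
    have hpatch := hf.isHelixPatch he₀
    have hq₀ : e₀ p ∈ e₀.target := e₀.map_source hp₀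
    obtain ⟨l, m, hlm⟩ := hpatch.exists_normalPair hε hθ
    -- The surface itself excludes `θ = 0`, which gives `g₁₁ > 0`.
    have hs := hlm.sin_ne_zero hε hθ hpatch hq₀
    refine ⟨⟨g11_pos hε hθ hs, g33_pos hε hθ, torus_subset_sphere hε hθ,
      isGeodesicOf_beta hε hθ⟩, ?_⟩
    obtain ⟨V, u, r, hqV, hVW, hframe⟩ := hpatch.exists_movingFrame hε hθ hq₀
    obtain ⟨e₁, a, b, c, d, ξ₁, ξ₂, ξ₃, hqe, hsrc, htar, hsm, hsm', hadm, hF⟩ :=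
      hframe.exists_coordinates hε hθ hqV
    have htar' : (e₀.trans e₁).target = rect a b c d := by
      rw [OpenPartialHomeomorph.trans_target, ← htar]
      exact Set.inter_eq_left.2 fun x hx => hVW (hsrc (e₁.map_target hx))
    have hmem : e₀.trans e₁ ∈ IsManifold.maximalAtlas (𝓡 2) ∞ M := by
      rw [IsManifold.mem_maximalAtlas_iff_contMDiffOn] at he₀ ⊢
      refine ⟨hsm.contMDiffOn.comp (he₀.1.mono ?_) ?_, he₀.2.comp (hsm'.contMDiffOn.mono ?_) ?_⟩
      · exact fun x hx => hx.1
      · exact fun x hx => hx.2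
      · exact fun x hx => hx.1
      · exact fun x hx => hx.2
    have hF' : ∀ x ∈ (e₀.trans e₁).target, f ((e₀.trans e₁).symm x) =
        helixMap ε θ (fun _ => Real.pi / 2) ξ₁ ξ₂ ξ₃ x := fun x hx => hF x hx.1
    refine ⟨e₀.trans e₁, a, b, c, d, fun _ => Real.pi / 2, ξ₁, ξ₂, ξ₃, hmem, ⟨hp₀, hqe⟩, htar',
      fun x hx => ?_, hadm, fun v _ => ⟨matA_mem_orthogonalGroup _ _ _ _,
        matA_commute_J1 _ _ _ _⟩, hF'⟩
    -- In these coordinates `f` is an admissible `A β`, so that `∂_u = T` follows from the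
    -- computation for the converse.
    intro w
    obtain ⟨w', rfl⟩ := (mfderiv_symm_bijective hmem hx).2 w
    have hev : f ∘ (e₀.trans e₁).symm =ᶠ[nhds x]
        helixMap ε θ (fun _ => Real.pi / 2) ξ₁ ξ₂ ξ₃ := by
      filter_upwards [(e₀.trans e₁).open_target.mem_nhds hx] with y hy using hF' y hy
    refine (congrArg (bergerMetric ε _ _) (push_mfderiv_symm hmem hf.smooth hx w')).trans ?_
    rw [push_mfderiv_symm hmem hf.smooth hx, hF' x hx, hev.fderiv_eq]
    exact hadm.hopf_tangent_part hε hθ isOpen_Ioo (htar' ▸ hx : x ∈ rect a b c d).2 w'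
  · have hsm : ContMDiff (𝓡 2) 𝓘(ℝ, R4) ∞ (fun x : U => helixMap ε θ ξ ξ₁ ξ₂ ξ₃ x) :=
      (hadm.contDiffOn_helixMap (ε := ε) (θ := θ)).contMDiffOn.comp_contMDiff
        contMDiff_subtype_val fun x => hU x x.2
    have hpush : ∀ (x : U) w, push (fun x : U => helixMap ε θ ξ ξ₁ ξ₂ ξ₃ x) x w =
        fderiv ℝ (helixMap ε θ ξ ξ₁ ξ₂ ξ₃) x w := fun x w =>
      mfderiv_comp_subtype_val (hsm x) w
    refine ⟨hsm, fun x => ?_, fun x w w' hw => ?_, fun x n hn => ?_⟩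
    · rw [mem_sphere_zero_iff_norm, ← pow_eq_one_iff_of_nonneg (norm_nonneg _) two_ne_zero,
        ← real_inner_self_eq_norm_sq, helixMap_eq, inner_rowsApply, row1_sq, inner_beta hε hθ,
        one_mul]
    · rw [hpush, hpush] at hw
      exact hinj x x.2 hw
    · refine hadm.angle hε hθ hI (hU x x.2) (hinj x x.2) hn.tangent_sphere (fun w => ?_) hn.unit
      exact (congrArg (bergerMetric ε _ n) (hpush x w).symm).trans (hn.normal w)
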